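/- Let $G=(V,E)$ be a finite connected simple graph with $n\ge 3$ vertices, with minimum degree $d_{\mathsf{min}}$ and average degree $d_{\mathsf{avg}}$. Let $\mathbf P$ be the transition matrix of the simple random walk (SRW) on $G$, which moves to a uniformly random neighbour in each step. Let $t_{\mathsf{hit}}=\max_{x,y\in V}\mathbb E_x[\tau_y]$ be the maximum expected time for the SRW started from $x$ to reach $y$, and let $t_{\mathsf{rel}}=1/(1-\tilde\lambda_2)$, where $\tilde\lambda_2$ is the second largest eigenvalue of the lazy random walk $(\mathbf I+\mathbf P)/2$. For $\varepsilon\in(0,1)$, the $\varepsilon$-time-biased random walk ($\varepsilon$-TBRW) on $G$ moves as follows: independently in each step, with probability $1-\varepsilon$ it moves to a uniformly random neighbour of the current vertex, and with probability $\varepsilon$ it moves to a neighbour drawn from a probability distribution on the neighbours of the current vertex, which is given by the strategy of a controller and may depend on the time and on the whole history of the walk. Let $t_{\mathsf{cov}}^{\varepsilon\mathsf{TB}}(G)$ be the maximum over start vertices $v\in V$ of the infimum, over all strategies, of the expected time for the $\varepsilon$-TBRW started from $v$ to visit every vertex of $G$. **Theorem.** There is an absolute constant $C>0$ such that for every finite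 connected simple graph $G$ with $n\geq 3$ vertices and every $\varepsilon\in(0,1)$, $$t_{\mathsf{cov}}^{\varepsilon\mathsf{TB}}(G)\;\le\; C\cdot\frac{t_{\mathsf{hit}}}{\varepsilon}\cdot\log\left(\frac{d_{\mathsf{avg}}\cdot t_{\mathsf{rel}}\cdot\log n}{d_{\mathsf{min}}}\right),$$ where $\log$ is the natural logarithm. -/

import Mathlib

open MeasureTheory ProbabilityTheory
open scoped ENNReal

noncomputable section

namespace BiasedWalk

variable {V : Type*} [Fintype V] [DecidableEq V]

/-- The history `(X_0, …, X_t)` of a process with values in `V` up to and including time `t`. -/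
abbrev History (V : Type*) (t : ℕ) : Type _ := (i : Finset.Iic t) → (fun _ : ℕ => V) i

/-- The current position, i.e. the last entry of a history. -/
def History.last {V : Type*} {t : ℕ} (h : History V t) : V := h ⟨t, Finset.mem_Iic.2 le_rfl⟩

/-- The transition matrix `P` of the simple random walk on `G`:
`P x y = 1 / d(x)` if `xy` is an edge, and `0` otherwise. -/
def transitionMatrix (G : SimpleGraph V) [DecidableRel G.Adj] : Matrix V V ℝ :=
  Matrix.of fun x y => if G.Adj x y then (1 : ℝ) / (G.degree x : ℝ) else 0

/-- The transition matrix `(I + P) / 2` of the lazy random walk. -/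
def lazyMatrix (G : SimpleGraph V) [DecidableRel G.Adj] : Matrix V V ℝ :=
  (1 / 2 : ℝ) • (1 + transitionMatrix G)

/-- The second largest eigenvalue of the lazy random walk. On a connected graph the largest
eigenvalue `1` is simple, so this is the largest eigenvalue different from `1`. -/
def lazyLambda₂ (G : SimpleGraph V) [DecidableRel G.Adj] : ℝ :=
  sSup {μ : ℝ | Module.End.HasEigenvalue (Matrix.toLin' (lazyMatrix G)) μ ∧ μ ≠ 1}

/-- The relaxation time `t_rel = 1 / (1 - λ₂)`, for the lazy random walk. -/
def relaxationTime (G : SimpleGraph V) [DecidableRel G.Adj] : ℝ :=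
  (1 - lazyLambda₂ G)⁻¹

/-- The average degree. -/
def avgDegree (G : SimpleGraph V) [DecidableRel G.Adj] : ℝ :=
  (∑ v, (G.degree v : ℝ)) / (Fintype.card V : ℝ)

/-- One step of the simple random walk from `x`: a uniformly random neighbour of `x`.
(An isolated vertex, which a connected graph with two vertices or more does not have,
is absorbing.) -/
def srwStep (G : SimpleGraph V) [DecidableRel G.Adj] (x : V) : PMF V :=
  if h : (G.neighborFinset x).Nonempty then PMF.uniformOfFinset (G.neighborFinset x) h
  else PMF.pure x

/-- A strategy of the controller of the time-dependent biased walk: for every time `t` and every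
history up to time `t`, a probability distribution on the neighbours of the current vertex, from
which the next vertex is drawn if the controller is given control of this step. -/
structure Strategy (G : SimpleGraph V) where
  /-- the row of the bias matrix at time `t` that belongs to the current vertex -/
  bias : (t : ℕ) → History V t → PMF V
  adj_of_mem_support : ∀ (t : ℕ) (h : History V t), ∀ y ∈ (bias t h).support, G.Adj h.last y

/-- One step of the `ε`-biased walk: with probability `1 - ε` it is drawn from `p`,
with probability `ε` from `b`. -/
def mix (ε : unitInterval) (p b : PMF V) : PMF V :=
  PMF.ofFintype (fun y => ENNReal.ofReal (1 - ε) * p y + ENNReal.ofReal ε * b y) (by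
    have hp : ∑ y, p y = 1 := by rw [← tsum_fintype (L := .unconditional V)]; exact p.tsum_coe
    have hb : ∑ y, b y = 1 := by rw [← tsum_fintype (L := .unconditional V)]; exact b.tsum_coe
    rw [Finset.sum_add_distrib, ← Finset.mul_sum, ← Finset.mul_sum, hp, hb, mul_one, mul_one,
      ← ENNReal.ofReal_add (sub_nonneg.2 ε.2.2) ε.2.1]
    simp)

variable [MeasurableSpace V] [DiscreteMeasurableSpace V]

/-- The Markov kernel from histories to the next vertex given by a family of distributions. -/
def stepKernel (step : (t : ℕ) → History V t → PMF V) (t : ℕ) : Kernel (History V t) V :=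
  Kernel.ofFunOfCountable fun h => (step t h).toMeasure

instance (step : (t : ℕ) → History V t → PMF V) (t : ℕ) : IsMarkovKernel (stepKernel step t) :=
  ⟨fun h => PMF.toMeasure.isProbabilityMeasure (step t h)⟩

/-- The law, on the space of infinite trajectories, of the process with `X_0 = u` such that,
conditionally on the history `h = (X_0, …, X_t)`, the vertex `X_{t+1}` has
distribution `step t h`. -/
def walkLaw (step : (t : ℕ) → History V t → PMF V) (u : V) : Measure (ℕ → V) :=
  Kernel.traj (X := fun _ : ℕ => V) (stepKernel step) 0 (fun _ => u)

/-- The law of the simple random walk on `G` from `u`. -/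
def srwLaw (G : SimpleGraph V) [DecidableRel G.Adj] (u : V) : Measure (ℕ → V) :=
  walkLaw (fun _ h => srwStep G h.last) u

/-- The law of the `ε`-time-biased walk on `G` from `u` under the strategy `S`. -/
def tbrwLaw (G : SimpleGraph V) [DecidableRel G.Adj] (ε : unitInterval) (S : Strategy G) (u : V) :
    Measure (ℕ → V) :=
  walkLaw (fun t h => mix ε (srwStep G h.last) (S.bias t h)) u

/-- The first time at which the trajectory `ω` is at `y` (infinite if there is none). -/
def hitTime {V : Type*} (y : V) (ω : ℕ → V) : ℝ≥0∞ :=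
  ⨅ (t : ℕ) (_ : ω t = y), (t : ℝ≥0∞)

/-- The first time by which the trajectory `ω` has visited every vertex
(infinite if there is none). -/
def coverTime {V : Type*} (ω : ℕ → V) : ℝ≥0∞ :=
  ⨅ (t : ℕ) (_ : ∀ v : V, ∃ s ≤ t, ω s = v), (t : ℝ≥0∞)

/-- The hitting time `t_hit = max_{x, y} E_x[τ_y]` of the simple random walk on `G`. -/
def tHit (G : SimpleGraph V) [DecidableRel G.Adj] : ℝ≥0∞ :=
  ⨆ (x : V) (y : V), ∫⁻ ω, hitTime y ω ∂(srwLaw G x)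

/-- The cover time of the `ε`-time-biased walk: the maximum over the start vertices of the
optimal (over all strategies) expected time until all vertices have been visited. -/
def tCov (G : SimpleGraph V) [DecidableRel G.Adj] (ε : unitInterval) : ℝ≥0∞ :=
  ⨆ u : V, ⨅ S : Strategy G, ∫⁻ ω, coverTime ω ∂(tbrwLaw G ε S u)

end BiasedWalk

end

noncomputable section

namespace BiasedWalk

/-! ### The simple and the biased walk: transition probabilities and the one-step Markov property.
-/

section Walk

variable {V : Type*} [Fintype V]

/-! Write n for the number of vertices, τ for the hitting time, K for the argument of the logarithm,
D for the degree sum and e = min(ε, 1/2). The strategy has two phases, each encoded by a nonnegative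
potential that dominates one plus its own expectation after a step; by a supermartingale argument
(`iInf_lintegral_coverTime_le`) such a potential bounds the expected cover time.

Phase one lasts about 2τ log K / e steps and needs nothing beyond the simple random walk. With h_v
the expected hitting time of v, the function 1 + h_v/τ lies in [1, 2] and contracts by 1 - 1/(2τ)
per step away from v. Hence the expected number of unvisited vertices falls below 2n(1 - 1/(2τ))^N
after N steps. Jensen's inequality for x ↦ x^e makes its e-th moment at most about (2n)^e / K.

Phase two steers towards the set U of unvisited vertices. A weighted sum of the probabilities that
the lazy walk is in U at time k, for k up to a multiple of T ≈ t_rel log n, gives a function g that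
is at least a constant times deg(U)/D and grows off U by a factor 1 + c/T per step in the mean. An
ε-share of steps to the best neighbour replaces g by the much larger g^(1-e) with growth of the same
order, since a mean mixed with a maximum dominates a power mean (`rpow_sum_le_mix`). With m
unvisited vertices the next one therefore costs at most 6T (Q/m)^(1-e), where Q is of order D/d_min.
Summation over m gives B m^e with B = 6T Q^(1-e)/e (`exists_cover_potential`).

The phases balance: B (2n)^e / K ≤ 6TQ/(eK) is of order n/e, because K is of the order of TQ/n.
Finally n ≤ 1 + τ, so phase two costs O(τ/ε). -/

theorem transitionMatrix_nonneg (G : SimpleGraph V) [DecidableRel G.Adj] (x y : V) :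
    0 ≤ transitionMatrix G x y := by
  simp only [transitionMatrix, Matrix.of_apply]
  split_ifs <;> positivity

theorem sum_transitionMatrix {G : SimpleGraph V} [DecidableRel G.Adj] {x : V}
    (hx : 0 < G.degree x) : ∑ y, transitionMatrix G x y = 1 := by
  have : (G.degree x : ℝ) ≠ 0 := by positivity
  simp only [transitionMatrix, Matrix.of_apply]
  rw [← Finset.sum_filter, Finset.sum_const, ← SimpleGraph.neighborFinset_eq_filter,
    SimpleGraph.card_neighborFinset_eq_degree, nsmul_eq_mul]
  field_simp

theorem srwStep_apply {G : SimpleGraph V} [DecidableRel G.Adj] {x : V}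
    (hx : 0 < G.degree x) (y : V) :
    srwStep G x y = ENNReal.ofReal (transitionMatrix G x y) := by
  have hne : (G.neighborFinset x).Nonempty := by
    rw [← Finset.card_pos, SimpleGraph.card_neighborFinset_eq_degree]; exact hx
  rw [srwStep, dif_pos hne, PMF.uniformOfFinset_apply]
  simp only [transitionMatrix, Matrix.of_apply, SimpleGraph.mem_neighborFinset,
    SimpleGraph.card_neighborFinset_eq_degree]
  split_ifs
  · rw [one_div, ENNReal.ofReal_inv_of_pos (by positivity), ENNReal.ofReal_natCast]
  · simp

theorem mix_srwStep_pure_apply [DecidableEq V] {G : SimpleGraph V} [DecidableRel G.Adj] {x : V}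
    (hx : 0 < G.degree x) (ε : unitInterval) (c y : V) :
    mix ε (srwStep G x) (PMF.pure c) y =
      ENNReal.ofReal ((1 - ε) * transitionMatrix G x y + ε * (if y = c then 1 else 0)) := by
  have h1 : (0 : ℝ) ≤ 1 - ε := sub_nonneg.2 ε.2.2
  have h2 : (0 : ℝ) ≤ ε := ε.2.1
  have h3 : (0 : ℝ) ≤ if y = c then 1 else 0 := by split_ifs <;> norm_num
  rw [ENNReal.ofReal_add (mul_nonneg h1 (transitionMatrix_nonneg G x y)) (mul_nonneg h2 h3),
    ENNReal.ofReal_mul h1, ENNReal.ofReal_mul h2, ← srwStep_apply hx]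
  simp only [mix, PMF.ofFintype_apply, PMF.pure_apply]
  split_ifs <;> simp

variable [MeasurableSpace V] [DiscreteMeasurableSpace V]

instance walkLaw.isProbabilityMeasure (step : (t : ℕ) → History V t → PMF V) (u : V) :
    IsProbabilityMeasure (walkLaw step u) := by
  unfold walkLaw; infer_instance

/-- The Markov property of the walk, for one step. -/
theorem lintegral_walkLaw_succ (step : (t : ℕ) → History V t → PMF V) (u : V) (t : ℕ)
    (F : History V t → V → ℝ≥0∞) :
    ∫⁻ ω, F (Preorder.frestrictLe t ω) (ω (t + 1)) ∂walkLaw step u =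
      ∫⁻ ω, ∑ y, step t (Preorder.frestrictLe t ω) y * F (Preorder.frestrictLe t ω) y
        ∂walkLaw step u := by
  have hF : Measurable (fun p : History V t × V => F p.1 p.2) := measurable_of_countable _
  have hm : Measurable (fun ω : ℕ → V => (Preorder.frestrictLe t ω : History V t)) := by
    fun_prop
  have key := Kernel.partialTraj_compProd_eq_map_traj (X := fun _ : ℕ => V)
    (κ := stepKernel step) (a := 0) (b := t) (Nat.zero_le t) (x₀ := fun _ => u)
  have h1 : ∫⁻ ω, F (Preorder.frestrictLe t ω) (ω (t + 1)) ∂walkLaw step u =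
      ∫⁻ p, F p.1 p.2 ∂((walkLaw step u).map
        (fun ω => ((Preorder.frestrictLe t ω : History V t), ω (t + 1)))) := by
    rw [lintegral_map hF (hm.prodMk (measurable_pi_apply _))]
  rw [h1]
  unfold walkLaw
  rw [← key, Measure.lintegral_compProd hF, ← Kernel.traj_map_frestrictLe_apply,
    lintegral_map (measurable_of_countable _) hm]
  refine lintegral_congr fun ω => ?_
  rw [lintegral_fintype]
  refine Finset.sum_congr rfl fun y _ => ?_
  rw [mul_comm]
  congr 1
  change (step t _).toMeasure {y} = _
  rw [PMF.toMeasure_apply_singleton _ _ (measurableSet_singleton y)]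

theorem ae_walkLaw_zero (step : (t : ℕ) → History V t → PMF V) (u : V) :
    ∀ᵐ ω ∂walkLaw step u, ω 0 = u := by
  have hm : Measurable (fun ω : ℕ → V => (Preorder.frestrictLe 0 ω : History V 0)) := by
    fun_prop
  have key := Kernel.traj_map_frestrictLe_apply (X := fun _ : ℕ => V)
    (κ := stepKernel step) 0 0 (fun _ => u)
  rw [Kernel.partialTraj_self, Kernel.id_apply] at key
  have h2 : ∀ᵐ h ∂((walkLaw step u).map
      (fun ω => (Preorder.frestrictLe 0 ω : History V 0))), h = fun _ => u := by
    unfold walkLaw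
    erw [key]
    rw [ae_dirac_eq]
    rfl
  filter_upwards [ae_of_ae_map hm.aemeasurable h2] with ω hω
  exact congrFun hω ⟨0, Finset.mem_Iic.2 le_rfl⟩

theorem measurable_of_frestrictLe {t : ℕ}
    (F : History V t → ℝ≥0∞) :
    Measurable (fun ω : ℕ → V => F (Preorder.frestrictLe t ω)) := by
  have hF : Measurable F := measurable_of_countable F
  exact hF.comp (by fun_prop)

end Walk

/-! ### Potentials that bound the optimal expected cover time. -/

section Cover

variable {V : Type*} [Fintype V] [DecidableEq V]

/-- The vertices that do not occur in a history. -/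
def History.unvisited {t : ℕ} (h : History V t) : Finset V :=
  Finset.univ.filter fun v => ∀ i, h i ≠ v

/-- The vertices that a trajectory has not visited by time `t`. -/
def unvisitedAt (t : ℕ) (ω : ℕ → V) : Finset V :=
  Finset.univ.filter fun v => ∀ s ≤ t, ω s ≠ v

theorem unvisited_frestrictLe (t : ℕ) (ω : ℕ → V) :
    History.unvisited (Preorder.frestrictLe t ω : History V t) = unvisitedAt t ω := by
  ext v
  simp [History.unvisited, unvisitedAt]

theorem unvisitedAt_succ (t : ℕ) (ω : ℕ → V) :
    unvisitedAt (t + 1) ω = (unvisitedAt t ω).erase (ω (t + 1)) := by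
  ext v
  simp only [unvisitedAt, Finset.mem_filter, Finset.mem_univ, true_and, Finset.mem_erase]
  constructor
  · exact fun h => ⟨(h (t + 1) le_rfl).symm, fun s hs => h s (by omega)⟩
  · rintro ⟨h1, h2⟩ s hs
    rcases Nat.lt_or_ge t s with h | h
    · obtain rfl : s = t + 1 := by omega
      exact h1.symm
    · exact h2 s h

theorem notMem_unvisitedAt (t : ℕ) (ω : ℕ → V) : ω t ∉ unvisitedAt t ω := by
  simp only [unvisitedAt, Finset.mem_filter, Finset.mem_univ, true_and]
  exact fun h => h t le_rfl rfl

theorem unvisitedAt_zero (ω : ℕ → V) : unvisitedAt 0 ω = Finset.univ.erase (ω 0) := by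
  ext v
  simp [unvisitedAt, eq_comm]

/-- The indicator of the event that some vertex is unvisited. -/
def uncovered (U : Finset V) : ℝ≥0∞ := if U = ∅ then 0 else 1

theorem coverTime_le_tsum (ω : ℕ → V) :
    coverTime ω ≤ ∑' t, uncovered (unvisitedAt t ω) := by
  by_cases h : ∃ t, unvisitedAt t ω = ∅
  · have h1 := Nat.find_spec h
    refine (iInf₂_le (Nat.find h) fun v => ?_).trans ?_
    · by_contra hv
      push Not at hv
      have : v ∈ unvisitedAt (Nat.find h) ω :=
        Finset.mem_filter.2 ⟨Finset.mem_univ v, hv⟩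
      rw [h1] at this
      simp at this
    · refine le_trans ?_ (ENNReal.sum_le_tsum (Finset.range (Nat.find h)))
      rw [Finset.sum_congr rfl (g := fun _ => 1)]
      · simp
      · intro t ht
        rw [uncovered, if_neg (Nat.find_min h (Finset.mem_range.1 ht))]
  · push Not at h
    have h1 : (fun t => uncovered (unvisitedAt t ω)) = fun _ => 1 := by
      funext t
      rw [uncovered, if_neg (h t).ne_empty]
    rw [h1, ENNReal.tsum_const_eq_top_of_ne_zero one_ne_zero]
    exact le_top

variable [MeasurableSpace V] [DiscreteMeasurableSpace V]

/-- A nonnegative function that dominates one plus its own expectation after a step of the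
biased walk, for some choice of the controller, bounds the optimal expected cover time. -/
theorem iInf_lintegral_coverTime_le {G : SimpleGraph V} [DecidableRel G.Adj]
    (hd : ∀ x, 0 < G.degree x) (ε : unitInterval) (W : ℕ → V → Finset V → ℝ)
    (hW : ∀ t x U, 0 ≤ W t x U) (hW0 : ∀ t x, W t x ∅ = 0)
    (hstep : ∀ t x U, ∃ y, G.Adj x y ∧ (x ∉ U → U.Nonempty →
      1 + ((1 - ε) * ∑ z, transitionMatrix G x z * W (t + 1) z (U.erase z) +
        ε * W (t + 1) y (U.erase y)) ≤ W t x U)) (u : V) :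
    ⨅ S : Strategy G, ∫⁻ ω, coverTime ω ∂(tbrwLaw G ε S u) ≤
      ENNReal.ofReal (W 0 u (Finset.univ.erase u)) := by
  choose c hc1 hc2 using hstep
  let S : Strategy G :=
    { bias := fun t h => PMF.pure (c t h.last h.unvisited)
      adj_of_mem_support := fun t h y hy => by
        rw [PMF.support_pure, Set.mem_singleton_iff] at hy
        rw [hy]
        exact hc1 _ _ _ }
  refine (iInf_le _ S).trans ?_
  have hε1 : (0 : ℝ) ≤ 1 - ε := sub_nonneg.2 ε.2.2
  have hε2 : (0 : ℝ) ≤ ε := ε.2.1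
  -- The supermartingale inequality for one step. Once everything is visited the cost is zero, and
  -- the inequality survives because W vanishes at the empty set.
  have hpt : ∀ t x U, x ∉ U →
      ∑ y, mix ε (srwStep G x) (PMF.pure (c t x U)) y *
        (uncovered U + ENNReal.ofReal (W (t + 1) y (U.erase y))) ≤ ENNReal.ofReal (W t x U) := by
    intro t x U hx
    rcases U.eq_empty_or_nonempty with rfl | hU
    · simp [uncovered, hW0]
    · have hnn : ∀ y, 0 ≤ (1 - ε) * transitionMatrix G x y +
          ε * (if y = c t x U then (1 : ℝ) else 0) := fun y =>
        add_nonneg (mul_nonneg hε1 (transitionMatrix_nonneg G x y))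
          (mul_nonneg hε2 (by split_ifs <;> norm_num))
      have h1 : ∀ y, mix ε (srwStep G x) (PMF.pure (c t x U)) y *
          (uncovered U + ENNReal.ofReal (W (t + 1) y (U.erase y))) =
          ENNReal.ofReal (((1 - ε) * transitionMatrix G x y +
            ε * (if y = c t x U then (1 : ℝ) else 0)) * (1 + W (t + 1) y (U.erase y))) := by
        intro y
        rw [mix_srwStep_pure_apply (hd x), ENNReal.ofReal_mul (hnn y),
          ENNReal.ofReal_add zero_le_one (hW _ _ _), uncovered, if_neg hU.ne_empty]
        simp
      rw [Finset.sum_congr rfl fun y _ => h1 y, ← ENNReal.ofReal_sum_of_nonneg]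
      · refine ENNReal.ofReal_le_ofReal (le_trans (le_of_eq ?_) (hc2 t x U hx hU))
        have h2 : ∀ y, ((1 - ε) * transitionMatrix G x y +
            ε * (if y = c t x U then (1 : ℝ) else 0)) * (1 + W (t + 1) y (U.erase y)) =
            (1 - ε) * transitionMatrix G x y +
            (1 - ε) * (transitionMatrix G x y * W (t + 1) y (U.erase y)) +
            ε * (if y = c t x U then (1 + W (t + 1) y (U.erase y)) else 0) := by
          intro y
          split_ifs <;> ring
        rw [Finset.sum_congr rfl fun y _ => h2 y, Finset.sum_add_distrib,
          Finset.sum_add_distrib, ← Finset.mul_sum, ← Finset.mul_sum, ← Finset.mul_sum,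
          Finset.sum_ite_eq' Finset.univ, sum_transitionMatrix (hd x)]
        simp only [Finset.mem_univ, if_true]
        ring
      · exact fun y _ => mul_nonneg (hnn y) (add_nonneg zero_le_one (hW _ _ _))
  set μ := tbrwLaw G ε S u with hμ
  have hmeas : ∀ t, Measurable fun ω : ℕ → V => uncovered (unvisitedAt t ω) := by
    intro t
    simp_rw [← unvisited_frestrictLe]
    exact measurable_of_frestrictLe fun h : History V t => uncovered h.unvisited
  -- Time spent uncovered so far plus the current potential is a supermartingale; discarding the
  -- potential bounds every partial sum for the cover time.
  have hbound : ∀ t, ∫⁻ ω, ∑ s ∈ Finset.range t, uncovered (unvisitedAt s ω) ∂μ +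
      ∫⁻ ω, ENNReal.ofReal (W t (ω t) (unvisitedAt t ω)) ∂μ ≤
      ENNReal.ofReal (W 0 u (Finset.univ.erase u)) := by
    intro t
    induction t with
    | zero =>
      have h0 : ∀ᵐ ω ∂μ, ENNReal.ofReal (W 0 (ω 0) (unvisitedAt 0 ω)) =
          ENNReal.ofReal (W 0 u (Finset.univ.erase u)) := by
        filter_upwards [ae_walkLaw_zero
          (fun t h => mix ε (srwStep G h.last) (S.bias t h)) u] with ω hω
        rw [unvisitedAt_zero, hω]
      rw [lintegral_congr_ae h0]
      simp [hμ, tbrwLaw]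
    | succ t ih =>
      refine le_trans ?_ ih
      simp_rw [Finset.sum_range_succ]
      rw [lintegral_add_right _ (hmeas t), add_assoc, ← lintegral_add_left (hmeas t)]
      refine add_le_add le_rfl ?_
      simp_rw [unvisitedAt_succ, ← unvisited_frestrictLe t]
      have := lintegral_walkLaw_succ (fun t h => mix ε (srwStep G h.last) (S.bias t h)) u t
        (fun h y => uncovered h.unvisited + ENNReal.ofReal (W (t + 1) y (h.unvisited.erase y)))
      rw [hμ, tbrwLaw, this]
      refine lintegral_mono fun ω => ?_
      refine hpt t _ _ ?_
      rw [unvisited_frestrictLe]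
      exact notMem_unvisitedAt t ω
  calc ∫⁻ ω, coverTime ω ∂μ
      ≤ ∫⁻ ω, ∑' t, uncovered (unvisitedAt t ω) ∂μ := lintegral_mono fun ω => coverTime_le_tsum ω
    _ = ∑' t, ∫⁻ ω, uncovered (unvisitedAt t ω) ∂μ :=
        lintegral_tsum fun t => (hmeas t).aemeasurable
    _ ≤ ENNReal.ofReal (W 0 u (Finset.univ.erase u)) := by
        refine ENNReal.tsum_le_of_sum_range_le fun t => ?_
        rw [← lintegral_finsetSum _ fun s _ => hmeas s]
        exact le_self_add.trans (hbound t)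

end Cover

end BiasedWalk

namespace BiasedWalk

/-! ### Expected hitting times of the simple random walk, as limits of truncated ones. -/

section Hitting

variable {V : Type*} [Fintype V] [DecidableEq V]

/-- The expectation, for the simple random walk from a given vertex, of the minimum of `n` and
the hitting time of `y`. -/
def truncatedHit (G : SimpleGraph V) [DecidableRel G.Adj] (y : V) : ℕ → V → ℝ
  | 0, _ => 0
  | n + 1, x => if x = y then 0 else 1 + ∑ z, transitionMatrix G x z * truncatedHit G y n z

theorem truncatedHit_nonneg (G : SimpleGraph V) [DecidableRel G.Adj] (y : V) (n : ℕ) (x : V) :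
    0 ≤ truncatedHit G y n x := by
  induction n generalizing x with
  | zero => simp [truncatedHit]
  | succ n ih =>
    rw [truncatedHit]
    split_ifs
    · exact le_rfl
    · exact add_nonneg zero_le_one
        (Finset.sum_nonneg fun z _ => mul_nonneg (transitionMatrix_nonneg G x z) (ih z))

theorem truncatedHit_self (G : SimpleGraph V) [DecidableRel G.Adj] (y : V) (n : ℕ) :
    truncatedHit G y n y = 0 := by
  cases n <;> simp [truncatedHit]

theorem truncatedHit_le_succ (G : SimpleGraph V) [DecidableRel G.Adj] (y : V) (n : ℕ) (x : V) :
    truncatedHit G y n x ≤ truncatedHit G y (n + 1) x := by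
  induction n generalizing x with
  | zero => exact truncatedHit_nonneg G y 1 x
  | succ n ih =>
    rw [truncatedHit, truncatedHit]
    split_ifs
    · exact le_rfl
    · gcongr with z
      · exact transitionMatrix_nonneg G x z
      · exact ih z

theorem sum_indicator_le_hitTime (y : V) (n : ℕ) (ω : ℕ → V) :
    ∑ s ∈ Finset.range n, (if y ∈ unvisitedAt s ω then (1 : ℝ≥0∞) else 0) ≤ hitTime y ω := by
  refine le_iInf₂ fun t ht => ?_
  have h : ∀ s ∈ Finset.range n, (if y ∈ unvisitedAt s ω then (1 : ℝ≥0∞) else 0) ≤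
      if s < t then 1 else 0 := by
    intro s _
    split_ifs with h1 h2
    · exact le_rfl
    · exact absurd ht ((Finset.mem_filter.1 h1).2 t (not_lt.1 h2))
    · exact zero_le
    · exact le_rfl
  refine (Finset.sum_le_sum h).trans ?_
  rw [← Finset.sum_filter, Finset.sum_const, nsmul_eq_mul, mul_one]
  have : (Finset.range n).filter (· < t) ⊆ Finset.range t := fun s hs =>
    Finset.mem_range.2 (Finset.mem_filter.1 hs).2
  exact_mod_cast (Finset.card_le_card this).trans (Finset.card_range t).le

variable [MeasurableSpace V] [DiscreteMeasurableSpace V]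

/-- Truncation keeps everything finite. The number of times before t at which y is still unvisited,
plus the truncated time left while y is unvisited, has constant expectation in t; at t = n only the
count remains, and it never exceeds the hitting time. -/
theorem truncatedHit_le_lintegral_hitTime {G : SimpleGraph V} [DecidableRel G.Adj]
    (hd : ∀ x, 0 < G.degree x) (x y : V) (n : ℕ) :
    ENNReal.ofReal (truncatedHit G y n x) ≤ ∫⁻ ω, hitTime y ω ∂(srwLaw G x) := by
  set μ := srwLaw G x with hμ
  let a : Finset V → ℝ≥0∞ := fun U => if y ∈ U then 1 else 0
  have hmeas : ∀ t, Measurable fun ω : ℕ → V => a (unvisitedAt t ω) := by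
    intro t
    simp_rw [← unvisited_frestrictLe]
    exact measurable_of_frestrictLe fun h : History V t => a h.unvisited
  have hbound : ∀ t ≤ n, ∫⁻ ω, ∑ s ∈ Finset.range t, a (unvisitedAt s ω) ∂μ +
      ∫⁻ ω, a (unvisitedAt t ω) * ENNReal.ofReal (truncatedHit G y (n - t) (ω t)) ∂μ =
      ENNReal.ofReal (truncatedHit G y n x) := by
    intro t
    induction t with
    | zero =>
      intro _
      have h0 : ∀ᵐ ω ∂μ, a (unvisitedAt 0 ω) *
          ENNReal.ofReal (truncatedHit G y (n - 0) (ω 0)) =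
          ENNReal.ofReal (truncatedHit G y n x) := by
        filter_upwards [ae_walkLaw_zero (fun t h => srwStep G h.last) x] with ω hω
        rw [hω, unvisitedAt_zero, hω, Nat.sub_zero]
        by_cases hxy : y = x
        · simp [hxy, truncatedHit_self]
        · simp [a, hxy]
      rw [lintegral_congr_ae h0]
      simp [hμ, srwLaw]
    | succ t ih =>
      intro ht
      rw [← ih (by omega)]
      simp_rw [Finset.sum_range_succ]
      rw [lintegral_add_right _ (hmeas t), add_assoc, ← lintegral_add_left (hmeas t)]
      congr 1
      obtain ⟨k, hk⟩ : ∃ k, n - t = k + 1 := ⟨n - t - 1, by omega⟩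
      have hk' : n - (t + 1) = k := by omega
      rw [hk, hk']
      have h1 : ∀ ω : ℕ → V, a (unvisitedAt t ω) + a (unvisitedAt (t + 1) ω) *
          ENNReal.ofReal (truncatedHit G y k (ω (t + 1))) =
          a (unvisitedAt t ω) * (1 + ENNReal.ofReal (truncatedHit G y k (ω (t + 1)))) := by
        intro ω
        rw [unvisitedAt_succ, mul_add, mul_one]
        congr 1
        by_cases hy : y = ω (t + 1)
        · rw [← hy, truncatedHit_self]; simp
        · simp [a, Finset.mem_erase, hy]
      simp_rw [h1, ← unvisited_frestrictLe t]
      have := lintegral_walkLaw_succ (fun t h => srwStep G h.last) x t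
        (fun h z => a h.unvisited * (1 + ENNReal.ofReal (truncatedHit G y k z)))
      rw [hμ, srwLaw, this]
      refine lintegral_congr fun ω => ?_
      rw [unvisited_frestrictLe]
      change ∑ z, srwStep G (ω t) z * _ = _
      by_cases hy : y ∈ unvisitedAt t ω
      · have hne : ω t ≠ y := (Finset.mem_filter.1 hy).2 t le_rfl
        simp only [a, if_pos hy, one_mul]
        rw [truncatedHit, if_neg hne, ← sum_transitionMatrix (hd (ω t)),
          ← Finset.sum_add_distrib, ENNReal.ofReal_sum_of_nonneg]
        · refine Finset.sum_congr rfl fun z _ => ?_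
          rw [srwStep_apply (hd _), ← mul_one_add,
            ENNReal.ofReal_mul (transitionMatrix_nonneg G _ _),
            ENNReal.ofReal_add zero_le_one (truncatedHit_nonneg G y k z), ENNReal.ofReal_one]
        · exact fun z _ => add_nonneg (transitionMatrix_nonneg G _ _)
            (mul_nonneg (transitionMatrix_nonneg G _ _) (truncatedHit_nonneg G y k z))
      · simp [a, hy]
  rw [← hbound n le_rfl]
  simp only [Nat.sub_self, truncatedHit, ENNReal.ofReal_zero, mul_zero, lintegral_zero, add_zero]
  exact lintegral_mono fun ω => sum_indicator_le_hitTime y n ω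

/-- If the hitting time is finite, the expected hitting times are superharmonic
up to the constant one. -/
theorem exists_hitting_supersolution {G : SimpleGraph V} [DecidableRel G.Adj]
    (hd : ∀ x, 0 < G.degree x) (hτ : tHit G ≠ ⊤) :
    ∃ h : V → V → ℝ, (∀ y x, 0 ≤ h y x) ∧ (∀ y x, h y x ≤ (tHit G).toReal) ∧
      ∀ y x, x ≠ y → 1 + ∑ z, transitionMatrix G x z * h y z ≤ h y x := by
  have hle : ∀ y n x, truncatedHit G y n x ≤ (tHit G).toReal := by
    intro y n x
    rw [← ENNReal.ofReal_le_iff_le_toReal hτ]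
    refine (truncatedHit_le_lintegral_hitTime hd x y n).trans ?_
    exact le_iSup₂ (f := fun x y => ∫⁻ ω, hitTime y ω ∂(srwLaw G x)) x y
  have hbdd : ∀ y x, BddAbove (Set.range fun n => truncatedHit G y n x) := fun y x =>
    ⟨_, Set.forall_mem_range.2 fun n => hle y n x⟩
  have hlim : ∀ y x, Filter.Tendsto (fun n => truncatedHit G y n x) Filter.atTop
      (nhds (⨆ n, truncatedHit G y n x)) := fun y x =>
    tendsto_atTop_ciSup (monotone_nat_of_le_succ fun n => truncatedHit_le_succ G y n x)
      (hbdd y x)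
  refine ⟨fun y x => ⨆ n, truncatedHit G y n x, fun y x =>
    Real.iSup_nonneg fun n => truncatedHit_nonneg G y n x,
    fun y x => ciSup_le fun n => hle y n x, fun y x hxy => ?_⟩
  have h1 : Filter.Tendsto (fun n => 1 + ∑ z, transitionMatrix G x z * truncatedHit G y n z)
      Filter.atTop (nhds (1 + ∑ z, transitionMatrix G x z * ⨆ n, truncatedHit G y n z)) :=
    tendsto_const_nhds.add (tendsto_finsetSum _ fun z _ => (hlim y z).const_mul _)
  refine le_of_tendsto' h1 fun n => ?_
  refine le_trans (le_of_eq ?_) (le_ciSup (hbdd y x) (n + 1))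
  rw [truncatedHit, if_neg hxy]

end Hitting

/-! ### Stationarity of the degree weights, and the comparison of n with the hitting time. -/

section Stationary

variable {V : Type*} [Fintype V]

theorem degree_mul_transitionMatrix (G : SimpleGraph V) [DecidableRel G.Adj] (x y : V) :
    (G.degree x : ℝ) * transitionMatrix G x y = if G.Adj x y then 1 else 0 := by
  simp only [transitionMatrix, Matrix.of_apply]
  split_ifs with h
  · have : 0 < G.degree x := (G.degree_pos_iff_exists_adj x).2 ⟨y, h⟩
    field_simp
  · simp

theorem sum_degree_mul_transitionMatrix_mul {G : SimpleGraph V} [DecidableRel G.Adj]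
    (f : V → ℝ) :
    ∑ x, (G.degree x : ℝ) * ∑ z, transitionMatrix G x z * f z = ∑ x, (G.degree x : ℝ) * f x := by
  simp_rw [Finset.mul_sum, ← mul_assoc, degree_mul_transitionMatrix]
  rw [Finset.sum_comm]
  refine Finset.sum_congr rfl fun z _ => ?_
  rw [← Finset.sum_mul]
  congr 1
  simp_rw [G.adj_comm _ z]
  rw [Finset.sum_boole, ← SimpleGraph.neighborFinset_eq_filter,
    SimpleGraph.card_neighborFinset_eq_degree]

/-- Kac's formula in disguise: the expected return time D/d(y) is at most 1 + τ. Summing the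
supersolution inequality against the stationary degree weights cancels h and leaves D ≤ d(y)(1 + τ);
for y of minimal degree, D ≥ n d(y). -/
theorem card_le_one_add_of_supersolution [DecidableEq V] {G : SimpleGraph V} [DecidableRel G.Adj]
    [Nonempty V] (hd : ∀ x, 0 < G.degree x) {τ : ℝ} {h : V → V → ℝ} (h0 : ∀ y x, 0 ≤ h y x)
    (hτ : ∀ y x, h y x ≤ τ)
    (hsup : ∀ y x, x ≠ y → 1 + ∑ z, transitionMatrix G x z * h y z ≤ h y x) :
    (Fintype.card V : ℝ) ≤ 1 + τ := by
  obtain ⟨y, -, hy⟩ := Finset.exists_min_image Finset.univ (fun x => G.degree x)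
    Finset.univ_nonempty
  have h1 : ∀ x, (G.degree x : ℝ) * (1 + ∑ z, transitionMatrix G x z * h y z) ≤
      (G.degree x : ℝ) * h y x + if x = y then (G.degree y : ℝ) * (1 + τ) else 0 := by
    intro x
    split_ifs with hxy
    · subst hxy
      have h3 : ∑ z, transitionMatrix G x z * h x z ≤ τ := by
        calc ∑ z, transitionMatrix G x z * h x z ≤ ∑ z, transitionMatrix G x z * τ := by
              gcongr with z
              · exact transitionMatrix_nonneg G x z
              · exact hτ x z
          _ = τ := by rw [← Finset.sum_mul, sum_transitionMatrix (hd x), one_mul]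
      have h4 : 0 ≤ (G.degree x : ℝ) * h x x := mul_nonneg (Nat.cast_nonneg _) (h0 x x)
      have h5 : (G.degree x : ℝ) * (1 + ∑ z, transitionMatrix G x z * h x z) ≤
        (G.degree x : ℝ) * (1 + τ) := by gcongr
      linarith
    · rw [add_zero]
      exact mul_le_mul_of_nonneg_left (hsup y x hxy) (Nat.cast_nonneg _)
  have h2 := Finset.sum_le_sum fun x (_ : x ∈ Finset.univ) => h1 x
  simp_rw [mul_add, mul_one] at h2
  rw [Finset.sum_add_distrib, Finset.sum_add_distrib, sum_degree_mul_transitionMatrix_mul,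
    Finset.sum_ite_eq' Finset.univ] at h2
  simp only [Finset.mem_univ, if_true] at h2
  have h3 : (Fintype.card V : ℝ) * G.degree y ≤ ∑ x, (G.degree x : ℝ) := by
    rw [← nsmul_eq_mul, ← Finset.card_univ]
    exact Finset.card_nsmul_le_sum _ _ _ fun x hx => by exact_mod_cast hy x hx
  have h4 : (0 : ℝ) < G.degree y := by exact_mod_cast hd y
  nlinarith

end Stationary

end BiasedWalk

namespace BiasedWalk

/-! ### Spectral gap and mixing of the lazy walk. -/

section Spectral

open Matrix

variable {V : Type*} [Fintype V] {G : SimpleGraph V} [DecidableRel G.Adj]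

theorem abs_sum_transitionMatrix_mul_le (hd : ∀ x, 0 < G.degree x) {f : V → ℝ} {M : ℝ}
    (hf : ∀ x, |f x| ≤ M) (x : V) : |∑ z, transitionMatrix G x z * f z| ≤ M := by
  calc |∑ z, transitionMatrix G x z * f z| ≤ ∑ z, |transitionMatrix G x z * f z| :=
        Finset.abs_sum_le_sum_abs _ _
    _ ≤ ∑ z, transitionMatrix G x z * M := by
        refine Finset.sum_le_sum fun z _ => ?_
        rw [abs_mul, abs_of_nonneg (transitionMatrix_nonneg G x z)]
        exact mul_le_mul_of_nonneg_left (hf z) (transitionMatrix_nonneg G x z)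
    _ = M := by rw [← Finset.sum_mul, sum_transitionMatrix (hd x), one_mul]

theorem sum_degree_le_card_sq : ∑ x, (G.degree x : ℝ) ≤ (Fintype.card V : ℝ) ^ 2 := by
  have h : ∀ x ∈ Finset.univ, (G.degree x : ℝ) ≤ Fintype.card V := fun x _ => by
    exact_mod_cast (G.degree_lt_card_verts x).le
  refine (Finset.sum_le_card_nsmul _ _ _ h).trans (le_of_eq ?_)
  rw [nsmul_eq_mul, Finset.card_univ, sq]

variable [DecidableEq V]

theorem lazyMatrix_mulVec (f : V → ℝ) (x : V) :
    (lazyMatrix G *ᵥ f) x = (f x + ∑ z, transitionMatrix G x z * f z) / 2 := by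
  rw [lazyMatrix, smul_mulVec, add_mulVec, one_mulVec, Pi.smul_apply, Pi.add_apply, smul_eq_mul]
  simp only [mulVec, dotProduct]
  ring

/-- At a maximum of |f|, averaging over neighbours cannot increase the modulus, so the eigenvalue 2μ
- 1 of the simple walk lies in [-1, 1]. -/
theorem lazy_eigenvalue_mem_Icc (hd : ∀ x, 0 < G.degree x) {f : V → ℝ} (hf : f ≠ 0) {μ : ℝ}
    (h : lazyMatrix G *ᵥ f = μ • f) : 0 ≤ μ ∧ μ ≤ 1 := by
  obtain ⟨w, hw⟩ := Function.ne_iff.1 hf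
  obtain ⟨x, -, hx⟩ := Finset.exists_max_image Finset.univ (fun x => |f x|) ⟨w, Finset.mem_univ w⟩
  have hpos : 0 < |f x| := (abs_pos.2 hw).trans_le (hx w (Finset.mem_univ w))
  have h1 := abs_sum_transitionMatrix_mul_le hd (fun z => hx z (Finset.mem_univ z)) x
  have h2 := congrFun h x
  rw [lazyMatrix_mulVec, Pi.smul_apply, smul_eq_mul] at h2
  have h3 : ∑ z, transitionMatrix G x z * f z = (2 * μ - 1) * f x := by linarith
  rw [h3, abs_mul, mul_le_iff_le_one_left hpos, abs_le] at h1
  constructor <;> linarith [h1.1, h1.2]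

theorem eq_of_lazy_eigenvalue_one (hG : G.Connected) {f : V → ℝ}
    (h : lazyMatrix G *ᵥ f = f) (x y : V) : f x = f y := by
  have h1 : G.lapMatrix ℝ *ᵥ f = 0 := by
    funext x
    rw [SimpleGraph.lapMatrix_mulVec_apply, Pi.zero_apply]
    have h2 := congrFun h x
    rw [lazyMatrix_mulVec] at h2
    have h3 : ∑ z, transitionMatrix G x z * f z = f x := by linarith
    rw [← h3, Finset.mul_sum]
    simp_rw [← mul_assoc, degree_mul_transitionMatrix, ite_mul, one_mul, zero_mul]
    rw [← Finset.sum_filter, ← SimpleGraph.neighborFinset_eq_filter, sub_self]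
  exact (G.lapMatrix_mulVec_eq_zero_iff_forall_reachable).1 h1 x y (hG.preconnected x y)

theorem hasEigenvalue_lazy {f : V → ℝ} (hf : f ≠ 0) {μ : ℝ}
    (h : lazyMatrix G *ᵥ f = μ • f) :
    Module.End.HasEigenvalue (Matrix.toLin' (lazyMatrix G)) μ :=
  Module.End.hasEigenvalue_of_hasEigenvector
    ⟨Module.End.mem_eigenspace_iff.2 (by rw [toLin'_apply, h]), hf⟩

theorem lazy_hasEigenvalue_mem_Icc (hd : ∀ x, 0 < G.degree x) {μ : ℝ}
    (h : Module.End.HasEigenvalue (Matrix.toLin' (lazyMatrix G)) μ) : 0 ≤ μ ∧ μ ≤ 1 := by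
  obtain ⟨f, hf⟩ := h.exists_hasEigenvector
  refine lazy_eigenvalue_mem_Icc hd hf.2 ?_
  rw [← toLin'_apply]
  exact hf.apply_eq_smul

theorem lazyLambda₂_nonneg (hd : ∀ x, 0 < G.degree x) : 0 ≤ lazyLambda₂ G :=
  Real.sSup_nonneg fun _ hμ => (lazy_hasEigenvalue_mem_Icc hd hμ.1).1

theorem lazyLambda₂_lt_one (hd : ∀ x, 0 < G.degree x) : lazyLambda₂ G < 1 := by
  have hfin : {μ : ℝ | Module.End.HasEigenvalue (Matrix.toLin' (lazyMatrix G)) μ ∧ μ ≠ 1}.Finite :=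
    (Module.End.finite_hasEigenvalue (Matrix.toLin' (lazyMatrix G))).subset fun _ h => h.1
  rcases Set.eq_empty_or_nonempty
    {μ : ℝ | Module.End.HasEigenvalue (Matrix.toLin' (lazyMatrix G)) μ ∧ μ ≠ 1} with he | hne
  -- If no eigenvalue differs from 1, the supremum takes the default value 0, which suffices.
  · rw [lazyLambda₂, he, Real.sSup_empty]
    exact zero_lt_one
  · have h := hne.csSup_mem hfin
    exact lt_of_le_of_ne (lazy_hasEigenvalue_mem_Icc hd h.1).2 h.2

theorem le_lazyLambda₂ (hd : ∀ x, 0 < G.degree x) {μ : ℝ}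
    (h : Module.End.HasEigenvalue (Matrix.toLin' (lazyMatrix G)) μ) (h1 : μ ≠ 1) :
    μ ≤ lazyLambda₂ G :=
  le_csSup ⟨1, fun _ hν => (lazy_hasEigenvalue_mem_Icc hd hν.1).2⟩ ⟨h, h1⟩

/-- The symmetric matrix that is conjugate to the transition matrix of the lazy walk. -/
def symmLazyMatrix (G : SimpleGraph V) [DecidableRel G.Adj] : Matrix V V ℝ :=
  Matrix.of fun x y => √(G.degree x) * lazyMatrix G x y / √(G.degree y)

theorem symmLazyMatrix_mulVec (hd : ∀ x, 0 < G.degree x) (f : V → ℝ) :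
    symmLazyMatrix G *ᵥ (fun y => √(G.degree y) * f y) =
      fun x => √(G.degree x) * (lazyMatrix G *ᵥ f) x := by
  funext x
  simp only [mulVec, dotProduct, symmLazyMatrix, of_apply, Finset.mul_sum]
  refine Finset.sum_congr rfl fun y _ => ?_
  have : √(G.degree y : ℝ) ≠ 0 := (Real.sqrt_pos.2 (by exact_mod_cast hd y)).ne'
  field_simp

theorem symmLazyMatrix_pow_mulVec (hd : ∀ x, 0 < G.degree x) (f : V → ℝ) (k : ℕ) :
    symmLazyMatrix G ^ k *ᵥ (fun y => √(G.degree y) * f y) =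
      fun x => √(G.degree x) * (lazyMatrix G ^ k *ᵥ f) x := by
  induction k with
  | zero => simp
  | succ k ih =>
    rw [pow_succ', ← mulVec_mulVec, ih, symmLazyMatrix_mulVec hd, mulVec_mulVec, ← pow_succ']

theorem isHermitian_symmLazyMatrix (hd : ∀ x, 0 < G.degree x) :
    (symmLazyMatrix G).IsHermitian := by
  ext x y
  have hs : ∀ x, √(G.degree x : ℝ) ≠ 0 := fun x =>
    (Real.sqrt_pos.2 (by exact_mod_cast hd x)).ne'
  have hsq : ∀ x, (√(G.degree x : ℝ)) ^ 2 = G.degree x := fun x =>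
    Real.sq_sqrt (Nat.cast_nonneg _)
  have hT : ∀ x y, (√(G.degree x : ℝ)) ^ 2 * transitionMatrix G x y =
      (√(G.degree y : ℝ)) ^ 2 * transitionMatrix G y x := by
    intro x y
    rw [hsq, hsq, degree_mul_transitionMatrix, degree_mul_transitionMatrix]
    simp [G.adj_comm]
  rw [conjTranspose_apply, star_trivial]
  simp only [symmLazyMatrix, of_apply, lazyMatrix, Matrix.smul_apply, Matrix.add_apply, smul_eq_mul]
  have := hT x y
  have hx := hs x
  have hy := hs y
  rcases eq_or_ne x y with rfl | hxy
  · rfl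
  · rw [one_apply_ne hxy, one_apply_ne hxy.symm, zero_add, zero_add]
    field_simp
    linarith

/-- Expand w in an orthonormal eigenbasis. Eigenvectors for 1 are √deg times a constant, by
connectedness, hence orthogonal to w. All other eigenvalues lie in [0, λ₂]; laziness rules out
negative ones, so no absolute values appear. -/
theorem sum_sq_symmLazyMatrix_pow_le (hG : G.Connected) (hd : ∀ x, 0 < G.degree x) {w : V → ℝ}
    (hw : ∑ x, √(G.degree x : ℝ) * w x = 0) (k : ℕ) :
    ∑ x, ((symmLazyMatrix G ^ k *ᵥ w) x) ^ 2 ≤ (lazyLambda₂ G ^ k) ^ 2 * ∑ x, w x ^ 2 := by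
  have hS := isHermitian_symmLazyMatrix hd
  set b := hS.eigenvectorBasis with hb
  have hs : ∀ x, √(G.degree x : ℝ) ≠ 0 := fun x =>
    (Real.sqrt_pos.2 (by exact_mod_cast hd x)).ne'
  have hparseval : ∀ v : V → ℝ, ∑ x, v x ^ 2 = ∑ i, ((b i).ofLp ⬝ᵥ v) ^ 2 := by
    intro v
    have h1 := b.sum_sq_norm_inner_right (WithLp.toLp 2 v)
    rw [EuclideanSpace.norm_sq_eq] at h1
    simp only [Real.norm_eq_abs, sq_abs] at h1
    rw [← h1]
    refine Finset.sum_congr rfl fun i _ => ?_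
    rw [EuclideanSpace.inner_eq_star_dotProduct, star_trivial, dotProduct_comm]
  have hcoef : ∀ i, (b i).ofLp ⬝ᵥ (symmLazyMatrix G ^ k *ᵥ w) =
      hS.eigenvalues i ^ k * ((b i).ofLp ⬝ᵥ w) := by
    intro i
    induction k with
    | zero => simp
    | succ k ih =>
      have hT : (symmLazyMatrix G)ᵀ = symmLazyMatrix G := by
        rw [← conjTranspose_eq_transpose_of_trivial]; exact hS
      rw [pow_succ', ← mulVec_mulVec, dotProduct_mulVec, ← mulVec_transpose, hT,
        hS.mulVec_eigenvectorBasis i, smul_dotProduct, ih, smul_eq_mul]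
      ring
  rw [hparseval, hparseval w, Finset.mul_sum]
  refine Finset.sum_le_sum fun i _ => ?_
  rw [hcoef, mul_pow]
  let f : V → ℝ := fun x => (b i).ofLp x / √(G.degree x)
  have hbf : (b i).ofLp = fun x => √(G.degree x) * f x := by
    funext x
    have := hs x
    simp only [f]
    field_simp
  have hf : f ≠ 0 := by
    intro hf
    refine b.orthonormal.ne_zero i ?_
    ext x
    rw [hbf, hf]
    simp
  have hLf : lazyMatrix G *ᵥ f = hS.eigenvalues i • f := by
    have h1 := hS.mulVec_eigenvectorBasis i
    rw [← hb, hbf, symmLazyMatrix_mulVec hd] at h1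
    funext x
    have h2 := congrFun h1 x
    simp only [Pi.smul_apply, smul_eq_mul] at h2 ⊢
    refine mul_left_cancel₀ (hs x) ?_
    rw [h2]; ring
  by_cases h1 : hS.eigenvalues i = 1
  · rw [h1, one_smul] at hLf
    have hconst := eq_of_lazy_eigenvalue_one hG hLf
    have h2 : (b i).ofLp ⬝ᵥ w = 0 := by
      have x₀ := hG.nonempty.some
      rw [hbf]
      simp only [dotProduct]
      calc ∑ x, √(G.degree x : ℝ) * f x * w x = f x₀ * ∑ x, √(G.degree x : ℝ) * w x := by
            rw [Finset.mul_sum]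
            refine Finset.sum_congr rfl fun x _ => ?_
            rw [hconst x x₀]; ring
        _ = 0 := by rw [hw, mul_zero]
    rw [h2]; simp
  · have h2 := le_lazyLambda₂ hd (hasEigenvalue_lazy hf hLf) h1
    have h3 := (lazy_eigenvalue_mem_Icc hd hf hLf).1
    gcongr

theorem lazyMatrix_pow_mulVec_const (hd : ∀ x, 0 < G.degree x) (c : ℝ) (k : ℕ) :
    lazyMatrix G ^ k *ᵥ (fun _ => c) = fun _ => c := by
  induction k with
  | zero => simp
  | succ k ih =>
    rw [pow_succ, ← mulVec_mulVec]
    have : lazyMatrix G *ᵥ (fun _ => c) = fun _ => c := by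
      funext x
      rw [lazyMatrix_mulVec, ← Finset.sum_mul, sum_transitionMatrix (hd x)]
      ring
    rw [this, ih]

/-- After a number of steps of the order of the relaxation time multiplied by `log n`, the lazy
walk is in a given set with a probability of at least half of its stationary probability. -/
theorem lazyMatrix_pow_indicator_ge (hG : G.Connected) (hd : ∀ x, 0 < G.degree x)
    {U : Finset V} (hU : U.Nonempty) {k : ℕ}
    (hk : lazyLambda₂ G ^ k * (2 * (Fintype.card V : ℝ) ^ 3) ≤ 1) (x : V) :
    (∑ v ∈ U, (G.degree v : ℝ)) / (2 * ∑ v, (G.degree v : ℝ)) ≤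
      (lazyMatrix G ^ k *ᵥ fun v => if v ∈ U then 1 else 0) x := by
  set D := ∑ v, (G.degree v : ℝ) with hD
  set n : ℝ := (Fintype.card V : ℝ) with hn
  have hn0 : 0 < n := by
    rw [hn]; exact_mod_cast Fintype.card_pos_iff.2 hG.nonempty
  have hd1 : ∀ v, (1 : ℝ) ≤ G.degree v := fun v => by exact_mod_cast hd v
  have hDpos : 0 < D := Finset.sum_pos (fun v _ => by linarith [hd1 v]) ⟨x, Finset.mem_univ x⟩
  set p := (∑ v ∈ U, (G.degree v : ℝ)) / D with hp
  have hDU : ∑ v ∈ U, (G.degree v : ℝ) ≤ D :=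
    Finset.sum_le_univ_sum_of_nonneg fun v => Nat.cast_nonneg _
  have hU1 : 1 ≤ ∑ v ∈ U, (G.degree v : ℝ) := by
    obtain ⟨v, hv⟩ := hU
    exact (hd1 v).trans (Finset.single_le_sum (f := fun v => (G.degree v : ℝ))
      (fun v _ => Nat.cast_nonneg _) hv)
  have hp0 : 0 ≤ p := by positivity
  have hp1 : p ≤ 1 := (div_le_one hDpos).2 hDU
  have hDn : D ≤ n ^ 2 := sum_degree_le_card_sq
  have hpn : 1 / n ^ 2 ≤ p := div_le_div₀ (by linarith) hU1 hDpos hDn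
  let φ : V → ℝ := fun v => (if v ∈ U then 1 else 0) - p
  have hsplit : (fun v => if v ∈ U then (1 : ℝ) else 0) = φ + fun _ => p := by
    funext v; simp [φ]
  have hw : ∑ v, √(G.degree v : ℝ) * (√(G.degree v) * φ v) = 0 := by
    simp_rw [← mul_assoc, Real.mul_self_sqrt (Nat.cast_nonneg _)]
    simp only [φ, mul_sub, mul_ite, mul_one, mul_zero]
    rw [Finset.sum_sub_distrib, ← Finset.sum_mul, ← Finset.sum_filter, Finset.filter_univ_mem]
    rw [← hD, hp]
    field_simp
    ring
  have hdec := sum_sq_symmLazyMatrix_pow_le hG hd hw k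
  rw [symmLazyMatrix_pow_mulVec hd] at hdec
  have hsq : ∑ v, (√(G.degree v : ℝ) * φ v) ^ 2 ≤ n ^ 2 := by
    refine le_trans (Finset.sum_le_sum fun v _ => ?_) hDn
    rw [mul_pow, Real.sq_sqrt (Nat.cast_nonneg _)]
    have : φ v ^ 2 ≤ 1 := by
      simp only [φ]
      split_ifs <;> nlinarith
    nlinarith [hd1 v]
  -- Since every degree is at least 1, the degree-weighted L² norm controls the value at x. The
  -- resulting error λ₂^k n is at most 1/(2n²) ≤ p/2 by the choice of k.
  have hx : ((lazyMatrix G ^ k *ᵥ φ) x) ^ 2 ≤ (lazyLambda₂ G ^ k * n) ^ 2 := by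
    calc ((lazyMatrix G ^ k *ᵥ φ) x) ^ 2
        ≤ (√(G.degree x : ℝ) * (lazyMatrix G ^ k *ᵥ φ) x) ^ 2 := by
          rw [mul_pow, Real.sq_sqrt (Nat.cast_nonneg _)]
          nlinarith [hd1 x, sq_nonneg ((lazyMatrix G ^ k *ᵥ φ) x)]
      _ ≤ ∑ v, (√(G.degree v : ℝ) * (lazyMatrix G ^ k *ᵥ φ) v) ^ 2 :=
          Finset.single_le_sum (f := fun v => (√(G.degree v : ℝ) * (lazyMatrix G ^ k *ᵥ φ) v) ^ 2)
            (fun v _ => sq_nonneg _) (Finset.mem_univ x)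
      _ ≤ (lazyLambda₂ G ^ k) ^ 2 * n ^ 2 :=
          hdec.trans (mul_le_mul_of_nonneg_left hsq (sq_nonneg _))
      _ = (lazyLambda₂ G ^ k * n) ^ 2 := by ring
  have hl0 : 0 ≤ lazyLambda₂ G ^ k := pow_nonneg (lazyLambda₂_nonneg hd) k
  have hx' := (abs_le.1 (abs_le_of_sq_le_sq hx (by positivity))).1
  have hsmall : lazyLambda₂ G ^ k * n ≤ (1 / n ^ 2) / 2 := by
    rw [div_div, le_div_iff₀ (by positivity)]
    linarith
  rw [hsplit, mulVec_add, lazyMatrix_pow_mulVec_const hd, Pi.add_apply]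
  have h2 : (∑ v ∈ U, (G.degree v : ℝ)) / (2 * D) = p / 2 := by
    rw [hp, div_div, mul_comm]
  rw [h2]
  linarith

end Spectral

end BiasedWalk

namespace BiasedWalk

/-! ### Power means under a best-neighbour bias, and summation by parts with linear weights. -/

section Boost

/-- Mixing an arithmetic mean with the maximum dominates the generalized mean of exponent
`1 / (1 - e)`. -/
theorem rpow_sum_le_mix {ι : Type*} (s : Finset ι) {p g : ι → ℝ} {e M : ℝ} (he0 : 0 ≤ e)
    (he1 : e ≤ 1) (hp : ∀ i ∈ s, 0 ≤ p i) (hg : ∀ i ∈ s, 0 ≤ g i) (hM : 0 ≤ M)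
    (hgM : ∀ i ∈ s, p i ≠ 0 → g i ≤ M) :
    (∑ i ∈ s, p i * g i) ^ (1 - e) ≤ (1 - e) * ∑ i ∈ s, p i * g i ^ (1 - e) + e * M ^ (1 - e) := by
  have he2 : 0 ≤ 1 - e := sub_nonneg.2 he1
  -- Pointwise g ≤ g^(1-e) M^e; the weighted AM-GM inequality then splits the product.
  have h1 : ∑ i ∈ s, p i * g i ≤ (∑ i ∈ s, p i * g i ^ (1 - e)) * M ^ e := by
    rw [Finset.sum_mul]
    refine Finset.sum_le_sum fun i hi => ?_
    rcases eq_or_ne (p i) 0 with h | h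
    · simp [h]
    · have h2 : g i = g i ^ (1 - e) * g i ^ e := by
        rw [← Real.rpow_add_of_nonneg (hg i hi) he2 he0, sub_add_cancel, Real.rpow_one]
      calc p i * g i = p i * (g i ^ (1 - e) * g i ^ e) := by rw [← h2]
        _ ≤ p i * (g i ^ (1 - e) * M ^ e) :=
            mul_le_mul_of_nonneg_left (mul_le_mul_of_nonneg_left
              (Real.rpow_le_rpow (hg i hi) (hgM i hi h) he0)
              (Real.rpow_nonneg (hg i hi) _)) (hp i hi)
        _ = p i * g i ^ (1 - e) * M ^ e := by ring
  have h3 : 0 ≤ ∑ i ∈ s, p i * g i ^ (1 - e) :=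
    Finset.sum_nonneg fun i hi => mul_nonneg (hp i hi) (Real.rpow_nonneg (hg i hi) _)
  calc (∑ i ∈ s, p i * g i) ^ (1 - e)
      ≤ ((∑ i ∈ s, p i * g i ^ (1 - e)) * M ^ e) ^ (1 - e) :=
        Real.rpow_le_rpow (Finset.sum_nonneg fun i hi => mul_nonneg (hp i hi) (hg i hi)) h1 he2
    _ = (∑ i ∈ s, p i * g i ^ (1 - e)) ^ (1 - e) * (M ^ (1 - e)) ^ e := by
        rw [Real.mul_rpow h3 (Real.rpow_nonneg hM _), ← Real.rpow_mul hM, ← Real.rpow_mul hM,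
          mul_comm e]
    _ ≤ _ := Real.geom_mean_le_arith_mean2_weighted he2 he0 h3 (Real.rpow_nonneg hM _) (by ring)

theorem sum_tent_succ (a : ℕ → ℝ) (N : ℕ) :
    ∑ k ∈ Finset.range N, ((N : ℝ) - k) * a (k + 1) + N * a 0 =
      ∑ k ∈ Finset.range N, ((N : ℝ) - k) * a k + ∑ k ∈ Finset.range N, a (k + 1) := by
  have hrec : ∀ (b : ℕ → ℝ) (N : ℕ), ∑ k ∈ Finset.range (N + 1), (((N + 1 : ℕ) : ℝ) - k) * b k =
      ∑ k ∈ Finset.range N, ((N : ℝ) - k) * b k + ∑ k ∈ Finset.range (N + 1), b k := by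
    intro b N
    have h : ∀ k, (((N + 1 : ℕ) : ℝ) - k) * b k = ((N : ℝ) - k) * b k + b k := by
      intro k; push_cast; ring
    simp_rw [h]
    rw [Finset.sum_add_distrib, Finset.sum_range_succ (fun k => ((N : ℝ) - k) * b k)]
    simp
  induction N with
  | zero => simp
  | succ N ih =>
    rw [hrec a, hrec fun k => a (k + 1)]
    have h2 := Finset.sum_range_succ' a N
    push_cast
    linarith

/-- Shifting a sequence that starts at 0 adds its plain sum to the linearly weighted one, and the
plain sum is at least 1/N of the weighted sum because all weights are at most N. -/
theorem tent_mul_le (a : ℕ → ℝ) (ha : ∀ k, 0 ≤ a k) (ha0 : a 0 = 0) {N : ℕ} (hN : 0 < N) :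
    (1 + 1 / (N : ℝ)) * ∑ k ∈ Finset.range N, ((N : ℝ) - k) * a k ≤
      ∑ k ∈ Finset.range N, ((N : ℝ) - k) * a (k + 1) := by
  have h1 := sum_tent_succ a N
  have hN' : (0 : ℝ) < N := by exact_mod_cast hN
  have h2 : 1 / (N : ℝ) * ∑ k ∈ Finset.range N, ((N : ℝ) - k) * a k ≤
      ∑ k ∈ Finset.range N, a k := by
    rw [Finset.mul_sum]
    refine Finset.sum_le_sum fun k _ => ?_
    rw [← mul_assoc]
    refine mul_le_of_le_one_left (ha k) ?_
    rw [one_div, inv_mul_le_iff₀ hN', mul_one]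
    linarith [Nat.cast_nonneg (α := ℝ) k]
  have h3 : ∑ k ∈ Finset.range N, a k ≤ ∑ k ∈ Finset.range N, a (k + 1) := by
    have h4 := Finset.sum_range_succ' a N
    rw [Finset.sum_range_succ] at h4
    linarith [ha N]
  rw [ha0, mul_zero, add_zero] at h1
  rw [add_mul, one_mul]
  linarith

end Boost

/-! ### Functions that grow off the unvisited set, and the potential for the second phase. -/

section Subsolution

open Matrix

variable {V : Type*} [Fintype V] [DecidableEq V] {G : SimpleGraph V} [DecidableRel G.Adj]

theorem lazyMatrix_pow_indicator_mem_Icc (hd : ∀ x, 0 < G.degree x) (U : Finset V) (k : ℕ)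
    (x : V) : (lazyMatrix G ^ k *ᵥ fun v => if v ∈ U then (1 : ℝ) else 0) x ∈ Set.Icc 0 1 := by
  induction k generalizing x with
  | zero => simp only [pow_zero, one_mulVec]; split_ifs <;> simp
  | succ k ih =>
    rw [pow_succ', ← mulVec_mulVec, lazyMatrix_mulVec]
    set f := lazyMatrix G ^ k *ᵥ fun v => if v ∈ U then (1 : ℝ) else 0
    have h1 : 0 ≤ ∑ z, transitionMatrix G x z * f z :=
      Finset.sum_nonneg fun z _ => mul_nonneg (transitionMatrix_nonneg G x z) (ih z).1
    have h2 : ∑ z, transitionMatrix G x z * f z ≤ 1 := by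
      rw [← sum_transitionMatrix (hd x)]
      exact Finset.sum_le_sum fun z _ =>
        mul_le_of_le_one_right (transitionMatrix_nonneg G x z) (ih z).2
    constructor <;> linarith [(ih x).1, (ih x).2]

/-- A function that is bounded below in terms of the stationary probability of `U` and grows in
expectation off `U` along the simple random walk. -/
theorem exists_subsolution (hG : G.Connected) (hd : ∀ x, 0 < G.degree x) {U : Finset V}
    (hU : U.Nonempty) {T : ℕ} (hT : 0 < T)
    (hmix : ∀ k ≥ T, lazyLambda₂ G ^ k * (2 * (Fintype.card V : ℝ) ^ 3) ≤ 1) :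
    ∃ g : V → ℝ, (∀ x, (∑ v ∈ U, (G.degree v : ℝ)) / (2 * ∑ v, (G.degree v : ℝ)) / 9 ≤ g x) ∧
      (∀ x, g x ≤ 1) ∧
      ∀ x ∉ U, (1 + 2 / (3 * T : ℝ)) * g x ≤ ∑ z, transitionMatrix G x z * g z := by
  let a : V → ℕ → ℝ := fun x k => (lazyMatrix G ^ k *ᵥ fun v => if v ∈ U then (1 : ℝ) else 0) x
  have ha : ∀ x k, a x k ∈ Set.Icc (0 : ℝ) 1 := fun x k =>
    lazyMatrix_pow_indicator_mem_Icc hd U k x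
  have hT' : (0 : ℝ) < T := by exact_mod_cast hT
  set q := (∑ v ∈ U, (G.degree v : ℝ)) / (2 * ∑ v, (G.degree v : ℝ)) with hq
  have hq0 : 0 ≤ q := by positivity
  -- With this length, the T times in [T, 2T) are past mixing and still carry weight at least T, so
  -- s ≥ T² q. Normalising by N² = 9T² gives the factor 1/9.
  let N := 3 * T
  have hN : (N : ℝ) = 3 * T := by simp [N]
  let s : V → ℝ := fun x => ∑ k ∈ Finset.range N, ((N : ℝ) - k) * a x k
  have hterm : ∀ x, ∀ k ∈ Finset.range N, 0 ≤ ((N : ℝ) - k) * a x k := by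
    intro x k hk
    refine mul_nonneg (sub_nonneg.2 ?_) (ha x k).1
    exact_mod_cast (Finset.mem_range.1 hk).le
  have hlow : ∀ x, (T : ℝ) ^ 2 * q ≤ s x := by
    intro x
    have hsub : Finset.Ico T (2 * T) ⊆ Finset.range N := by
      intro k hk
      rw [Finset.mem_Ico] at hk
      rw [Finset.mem_range]
      omega
    refine le_trans ?_ (Finset.sum_le_sum_of_subset_of_nonneg hsub fun k hk _ => hterm x k hk)
    have h1 : ∀ k ∈ Finset.Ico T (2 * T), (T : ℝ) * q ≤ ((N : ℝ) - k) * a x k := by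
      intro k hk
      rw [Finset.mem_Ico] at hk
      have h2 : (k : ℝ) ≤ 2 * T := by exact_mod_cast hk.2.le
      have h3 := lazyMatrix_pow_indicator_ge hG hd hU (hmix k hk.1) x
      exact mul_le_mul (by linarith) h3 hq0 (by linarith)
    refine le_trans (le_of_eq ?_) (Finset.card_nsmul_le_sum _ _ _ h1)
    rw [Nat.card_Ico, nsmul_eq_mul, two_mul, Nat.add_sub_cancel]
    ring
  have hup : ∀ x, s x ≤ (N : ℝ) ^ 2 := by
    intro x
    refine (Finset.sum_le_card_nsmul _ _ (N : ℝ) fun k hk => ?_).trans (le_of_eq ?_)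
    · have h1 : (0 : ℝ) ≤ (N : ℝ) - k := sub_nonneg.2 (by exact_mod_cast (Finset.mem_range.1 hk).le)
      exact (mul_le_of_le_one_right h1 (ha x k).2).trans
        (sub_le_self _ (Nat.cast_nonneg k))
    · rw [Finset.card_range, nsmul_eq_mul, sq]
  have hstep : ∀ x ∉ U, (1 + 2 / (N : ℝ)) * s x ≤ ∑ z, transitionMatrix G x z * s z := by
    intro x hx
    -- The term at time 0 is the indicator of U and vanishes at x. The lazy growth rate 1/N doubles
    -- to 2/N for the simple walk, because a lazy step stays put with weight one half.
    have h1 := tent_mul_le (a x) (fun k => (ha x k).1) (by simp [a, hx]) (N := N) (by omega)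
    have h2 : ∑ k ∈ Finset.range N, ((N : ℝ) - k) * a x (k + 1) =
        (s x + ∑ z, transitionMatrix G x z * s z) / 2 := by
      have h3 : ∀ k, a x (k + 1) = (a x k + ∑ z, transitionMatrix G x z * a z k) / 2 := by
        intro k
        simp only [a]
        rw [pow_succ', ← mulVec_mulVec, lazyMatrix_mulVec]
      simp_rw [h3, s, Finset.mul_sum]
      rw [Finset.sum_comm, ← Finset.sum_add_distrib, Finset.sum_div]
      refine Finset.sum_congr rfl fun k _ => ?_
      rw [mul_div_assoc', mul_add, Finset.mul_sum]
      congr 2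
      exact Finset.sum_congr rfl fun z _ => by ring
    rw [h2] at h1
    change (1 + 1 / (N : ℝ)) * s x ≤ _ at h1
    have h4 : (2 / (N : ℝ)) * s x = 2 * ((1 / (N : ℝ)) * s x) := by ring
    linarith
  refine ⟨fun x => s x / (N : ℝ) ^ 2, fun x => ?_, fun x => ?_, fun x hx => ?_⟩
  · have h := hlow x
    rw [div_le_div_iff₀ (by norm_num) (by rw [hN]; positivity), hN]
    nlinarith
  · exact div_le_one_of_le₀ (hup x) (by positivity)
  · have h := hstep x hx
    have h5 : ∑ z, transitionMatrix G x z * (s z / (N : ℝ) ^ 2) =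
        (∑ z, transitionMatrix G x z * s z) / (N : ℝ) ^ 2 := by
      rw [Finset.sum_div]
      exact Finset.sum_congr rfl fun z _ => by ring
    rw [h5, ← hN, mul_div_assoc']
    gcongr

/-- The gain from control: raising the subsolution to the power 1 - e improves its lower bound,
while steering to the neighbour with the largest value pays for the loss from concavity. -/
theorem exists_boosted_subsolution (hG : G.Connected) (hd : ∀ x, 0 < G.degree x) {U : Finset V}
    (hU : U.Nonempty) {T : ℕ} (hT : 0 < T)
    (hmix : ∀ k ≥ T, lazyLambda₂ G ^ k * (2 * (Fintype.card V : ℝ) ^ 3) ≤ 1)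
    {ε e : ℝ} (he0 : 0 < e) (he : e ≤ 1 / 2) (heε : e ≤ ε) :
    ∃ f : V → ℝ,
      (∀ x, ((∑ v ∈ U, (G.degree v : ℝ)) / (2 * ∑ v, (G.degree v : ℝ)) / 9) ^ (1 - e) ≤ f x) ∧
      (∀ x, f x ≤ 1) ∧
      ∀ x, ∃ y, G.Adj x y ∧ (x ∉ U →
        (1 + 1 / (6 * T : ℝ)) * f x ≤
          (1 - ε) * ∑ z, transitionMatrix G x z * f z + ε * f y) := by
  obtain ⟨g, hg1, hg2, hg3⟩ := exists_subsolution hG hd hU hT hmix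
  have hT' : (0 : ℝ) < T := by exact_mod_cast hT
  set q := (∑ v ∈ U, (G.degree v : ℝ)) / (2 * ∑ v, (G.degree v : ℝ)) with hq
  have hq0 : 0 ≤ q / 9 := by positivity
  have hg0 : ∀ x, 0 ≤ g x := fun x => hq0.trans (hg1 x)
  have he1 : 0 ≤ 1 - e := by linarith
  refine ⟨fun x => g x ^ (1 - e), fun x => Real.rpow_le_rpow hq0 (hg1 x) he1,
    fun x => Real.rpow_le_one (hg0 x) (hg2 x) he1, fun x => ?_⟩
  obtain ⟨y, hy, hmax⟩ := Finset.exists_max_image (G.neighborFinset x) g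
    (by rw [← Finset.card_pos, SimpleGraph.card_neighborFinset_eq_degree]; exact hd x)
  refine ⟨y, (SimpleGraph.mem_neighborFinset _ _ _).1 hy, fun hx => ?_⟩
  have hzy : ∀ z, transitionMatrix G x z ≠ 0 → g z ≤ g y := by
    intro z hz
    refine hmax z ((SimpleGraph.mem_neighborFinset _ _ _).2 ?_)
    by_contra h
    exact hz (by simp [transitionMatrix, h])
  have h1 := rpow_sum_le_mix Finset.univ (p := transitionMatrix G x) (g := g) he0.le
    (by linarith) (fun z _ => transitionMatrix_nonneg G x z) (fun z _ => hg0 z) (hg0 y)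
    (fun z _ => hzy z)
  have h2 : ∑ z, transitionMatrix G x z * g z ^ (1 - e) ≤ g y ^ (1 - e) := by
    calc ∑ z, transitionMatrix G x z * g z ^ (1 - e)
        ≤ ∑ z, transitionMatrix G x z * g y ^ (1 - e) := by
          refine Finset.sum_le_sum fun z _ => ?_
          rcases eq_or_ne (transitionMatrix G x z) 0 with h | h
          · simp [h]
          · exact mul_le_mul_of_nonneg_left (Real.rpow_le_rpow (hg0 z) (hzy z h) he1)
              (transitionMatrix_nonneg G x z)
      _ = g y ^ (1 - e) := by rw [← Finset.sum_mul, sum_transitionMatrix (hd x), one_mul]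
  -- Here e ≤ 1/2 matters: with c = 1/(6T) ≤ 1, (1 + 4c)^(1-e) ≥ √(1 + 4c) ≥ 1 + c.
  have h3 : 1 + 1 / (6 * T : ℝ) ≤ (1 + 2 / (3 * T : ℝ)) ^ (1 - e) := by
    set c := 1 / (6 * T : ℝ) with hc
    have hc0 : 0 < c := by positivity
    have hc1 : c ≤ 1 := by
      rw [hc, div_le_one (by positivity)]
      have : (1 : ℝ) ≤ T := by exact_mod_cast hT
      linarith
    have h4 : 1 + 2 / (3 * T : ℝ) = 1 + 4 * c := by rw [hc]; field_simp; ring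
    rw [h4]
    calc 1 + c = ((1 + c) ^ (2 : ℝ)) ^ (1 / 2 : ℝ) := by
          rw [← Real.rpow_mul (by linarith)]; norm_num
      _ ≤ (1 + 4 * c) ^ (1 / 2 : ℝ) := by
          refine Real.rpow_le_rpow (by positivity) ?_ (by norm_num)
          rw [Real.rpow_two]
          nlinarith
      _ ≤ (1 + 4 * c) ^ (1 - e) :=
          Real.rpow_le_rpow_of_exponent_le (by linarith) (by linarith)
  calc (1 + 1 / (6 * T : ℝ)) * g x ^ (1 - e)
      ≤ (1 + 2 / (3 * T : ℝ)) ^ (1 - e) * g x ^ (1 - e) :=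
        mul_le_mul_of_nonneg_right h3 (Real.rpow_nonneg (hg0 x) _)
    _ = ((1 + 2 / (3 * T : ℝ)) * g x) ^ (1 - e) := by
        rw [Real.mul_rpow (by positivity) (hg0 x)]
    _ ≤ (∑ z, transitionMatrix G x z * g z) ^ (1 - e) :=
        Real.rpow_le_rpow (mul_nonneg (by positivity) (hg0 x)) (hg3 x hx) he1
    -- The mean is at most the maximum, so raising the weight of the maximum from e to ε only helps.
    _ ≤ _ := h1.trans (by nlinarith)

/-- Bernoulli's inequality for (1 - 1/m)^e. It is the telescoping form of the bound m^e / e for the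
sum of j^(e-1) over j ≤ m. -/
theorem rpow_add_rpow_sub_one_le {m e : ℝ} (hm : 1 ≤ m) (he0 : 0 ≤ e) (he1 : e ≤ 1) :
    e * m ^ (e - 1) + (m - 1) ^ e ≤ m ^ e := by
  have hm0 : 0 < m := by linarith
  have h1 : (m - 1) ^ e = m ^ e * (1 + -(1 / m)) ^ e := by
    have h2 : -1 ≤ -(1 / m) := neg_le_neg ((div_le_one hm0).2 hm)
    rw [← Real.mul_rpow hm0.le (by linarith)]
    congr 1
    field_simp
    ring
  have h2 : (1 + -(1 / m)) ^ e ≤ 1 + e * -(1 / m) :=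
    rpow_one_add_le_one_add_mul_self (neg_le_neg ((div_le_one hm0).2 hm)) he0 he1
  have h3 : m ^ (e - 1) = m ^ e * (1 / m) := by
    rw [Real.rpow_sub_one hm0.ne', div_eq_mul_one_div]
  rw [h1, h3]
  nlinarith [Real.rpow_nonneg hm0.le e]

/-- A time-independent potential for covering the remaining vertices one after the other with a
controller that aims for the set of unvisited vertices. -/
theorem exists_cover_potential (hG : G.Connected) (hd : ∀ x, 0 < G.degree x) {T : ℕ} (hT : 0 < T)
    (hmix : ∀ k ≥ T, lazyLambda₂ G ^ k * (2 * (Fintype.card V : ℝ) ^ 3) ≤ 1)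
    {ε e Q B : ℝ} (he0 : 0 < e) (he : e ≤ 1 / 2) (heε : e ≤ ε) (hε : ε ≤ 1) (hQ0 : 0 < Q)
    (hQ : 18 * ∑ v, (G.degree v : ℝ) ≤ Q * G.minDegree) (hB : B = 6 * T * Q ^ (1 - e) / e) :
    ∃ W : V → Finset V → ℝ, (∀ x, W x ∅ = 0) ∧ (∀ x U, 0 ≤ W x U) ∧
      (∀ x U, W x U ≤ B * (U.card : ℝ) ^ e) ∧
      ∀ x U, ∃ y, G.Adj x y ∧ (x ∉ U → U.Nonempty →
        1 + ((1 - ε) * ∑ z, transitionMatrix G x z * W z (U.erase z) + ε * W y (U.erase y)) ≤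
          W x U) := by
  have hf : ∀ U : Finset V, ∃ f : V → ℝ, U.Nonempty →
      (∀ x, ((U.card : ℝ) / Q) ^ (1 - e) ≤ f x) ∧ (∀ x, f x ≤ 1) ∧
      ∀ x, ∃ y, G.Adj x y ∧ (x ∉ U → (1 + 1 / (6 * T : ℝ)) * f x ≤
          (1 - ε) * ∑ z, transitionMatrix G x z * f z + ε * f y) := by
    intro U
    by_cases hU : U.Nonempty
    · obtain ⟨f, h1, h2, h3⟩ := exists_boosted_subsolution hG hd hU hT hmix he0 he heε
      refine ⟨f, fun _ => ⟨fun x => le_trans ?_ (h1 x), h2, h3⟩⟩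
      refine Real.rpow_le_rpow (by positivity) ?_ (by linarith)
      have h4 : (U.card : ℝ) * G.minDegree ≤ ∑ v ∈ U, (G.degree v : ℝ) := by
        rw [← nsmul_eq_mul]
        exact Finset.card_nsmul_le_sum _ _ _ fun v _ => by exact_mod_cast G.minDegree_le_degree v
      have hD : 0 < ∑ v, (G.degree v : ℝ) :=
        Finset.sum_pos (fun v _ => by exact_mod_cast hd v) (hU.mono (Finset.subset_univ U))
      rw [div_div, div_le_div_iff₀ hQ0 (by positivity)]
      calc (U.card : ℝ) * ((2 * ∑ v, (G.degree v : ℝ)) * 9)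
          = U.card * (18 * ∑ v, (G.degree v : ℝ)) := by ring
        _ ≤ U.card * (Q * G.minDegree) := by gcongr
        _ = U.card * G.minDegree * Q := by ring
        _ ≤ (∑ v ∈ U, (G.degree v : ℝ)) * Q := by gcongr
    · exact ⟨0, fun h => absurd h hU⟩
  choose f hf using hf
  have hT' : (0 : ℝ) < T := by exact_mod_cast hT
  have hB0 : 0 < B := by rw [hB]; positivity
  -- The first term pays for reaching U, the second for the vertices left afterwards. The
  -- coefficient e B m^(e-1) equals 6T (Q/m)^(1-e).
  let F : V → Finset V → ℝ := fun z U =>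
    e * B * (U.card : ℝ) ^ (e - 1) * (1 - f U z) + B * ((U.card : ℝ) - 1) ^ e
  let W : V → Finset V → ℝ := fun z U => if U = ∅ then 0 else F z U
  have hcard : ∀ U : Finset V, U.Nonempty → (1 : ℝ) ≤ U.card := fun U hU => by
    exact_mod_cast hU.card_pos
  have hF1 : ∀ z U, U.Nonempty → B * ((U.card : ℝ) - 1) ^ e ≤ F z U := by
    intro z U hU
    have h1 : 0 ≤ 1 - f U z := sub_nonneg.2 ((hf U hU).2.1 z)
    have : 0 ≤ e * B * (U.card : ℝ) ^ (e - 1) * (1 - f U z) := by positivity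
    simp only [F]
    linarith
  have hF2 : ∀ z U, U.Nonempty → F z U ≤ B * (U.card : ℝ) ^ e := by
    intro z U hU
    have h0 : 0 ≤ f U z := le_trans (by positivity) ((hf U hU).1 z)
    have h1 := rpow_add_rpow_sub_one_le (hcard U hU) he0.le (by linarith)
    have h2 : e * B * (U.card : ℝ) ^ (e - 1) * (1 - f U z) ≤ e * B * (U.card : ℝ) ^ (e - 1) :=
      mul_le_of_le_one_right (by positivity) (by linarith)
    calc F z U ≤ e * B * (U.card : ℝ) ^ (e - 1) + B * ((U.card : ℝ) - 1) ^ e := by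
          simp only [F]; linarith
      _ = B * (e * (U.card : ℝ) ^ (e - 1) + ((U.card : ℝ) - 1) ^ e) := by ring
      _ ≤ _ := by gcongr
  have hW : ∀ z U, W z U ≤ B * (U.card : ℝ) ^ e := by
    intro z U
    rcases U.eq_empty_or_nonempty with rfl | hU
    · simp only [W, if_true]; positivity
    · simp only [W, if_neg hU.ne_empty]; exact hF2 z U hU
  refine ⟨W, fun x => if_pos rfl, fun x U => ?_, hW, fun x U => ?_⟩
  · rcases U.eq_empty_or_nonempty with rfl | hU
    · simp [W]
    · simp only [W, if_neg hU.ne_empty]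
      have := hcard U hU
      exact le_trans (mul_nonneg hB0.le (Real.rpow_nonneg (by linarith) _)) (hF1 x U hU)
  · by_cases hU : U.Nonempty
    · obtain ⟨y, hy, hxy⟩ := (hf U hU).2.2 x
      refine ⟨y, hy, fun hx _ => ?_⟩
      -- Entering U leaves one vertex fewer, which the second term of F already covers; so F may be
      -- used with U frozen during the step.
      have hWF : ∀ z, W z (U.erase z) ≤ F z U := by
        intro z
        by_cases hz : z ∈ U
        · refine (hW z _).trans (le_trans (le_of_eq ?_) (hF1 z U hU))
          rw [Finset.card_erase_of_mem hz, Nat.cast_sub hU.card_pos, Nat.cast_one]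
        · rw [Finset.erase_eq_of_notMem hz]
          simp only [W, if_neg hU.ne_empty]
          exact le_rfl
      have hmain := hxy hx
      set R := e * B * (U.card : ℝ) ^ (e - 1) with hR
      have hm := hcard U hU
      have hR0 : 0 ≤ R := by positivity
      have hsum : ∑ z, transitionMatrix G x z * F z U =
          R + B * ((U.card : ℝ) - 1) ^ e - R * ∑ z, transitionMatrix G x z * f U z := by
        have h1 : ∀ z, transitionMatrix G x z * F z U =
            transitionMatrix G x z * (R + B * ((U.card : ℝ) - 1) ^ e) -
              R * (transitionMatrix G x z * f U z) := by
          intro z; simp only [F]; ring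
        simp_rw [h1]
        rw [Finset.sum_sub_distrib, ← Finset.sum_mul, ← Finset.mul_sum,
          sum_transitionMatrix (hd x), one_mul]
      -- B is chosen so that the guaranteed growth of f lowers the potential by at least the one
      -- step spent.
      have hgain : 1 ≤ R * (1 / (6 * T : ℝ) * f U x) := by
        have h1 : (U.card : ℝ) ^ (e - 1) * ((U.card : ℝ) / Q) ^ (1 - e) = (Q ^ (1 - e))⁻¹ := by
          rw [Real.div_rpow (by positivity) hQ0.le, mul_div_assoc',
            ← Real.rpow_add (by linarith)]
          simp
        calc (1 : ℝ) = e * B * (Q ^ (1 - e))⁻¹ * (1 / (6 * T : ℝ)) := by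
              rw [hB]
              have : Q ^ (1 - e) ≠ 0 := (Real.rpow_pos_of_pos hQ0 _).ne'
              field_simp
          _ = R * (1 / (6 * T : ℝ) * ((U.card : ℝ) / Q) ^ (1 - e)) := by rw [← h1, hR]; ring
          _ ≤ _ := by
              gcongr
              exact (hf U hU).1 x
      have hle : (1 - ε) * ∑ z, transitionMatrix G x z * W z (U.erase z) +
          ε * W y (U.erase y) ≤ (1 - ε) * ∑ z, transitionMatrix G x z * F z U + ε * F y U := by
        have hε0 : 0 ≤ ε := by linarith
        refine add_le_add (mul_le_mul_of_nonneg_left (Finset.sum_le_sum fun z _ =>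
          mul_le_mul_of_nonneg_left (hWF z) (transitionMatrix_nonneg G x z)) (by linarith))
          (mul_le_mul_of_nonneg_left (hWF y) hε0)
      have hFx : W x U = R * (1 - f U x) + B * ((U.card : ℝ) - 1) ^ e := by
        simp only [W, if_neg hU.ne_empty, F, hR]
      have hFy : F y U = R * (1 - f U y) + B * ((U.card : ℝ) - 1) ^ e := rfl
      rw [hsum, hFy] at hle
      rw [hFx]
      have h6 := mul_le_mul_of_nonneg_left hmain hR0
      nlinarith
    · obtain ⟨y, hy⟩ := (G.degree_pos_iff_exists_adj x).1 (hd x)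
      exact ⟨y, hy, fun _ h => absurd h hU⟩

end Subsolution

end BiasedWalk

namespace BiasedWalk

/-! ### The first phase, the combination of both phases, and the constants. -/

section Main

variable {V : Type*} [Fintype V] {G : SimpleGraph V} [DecidableRel G.Adj]

/-- A potential for the vertices left over by a simple random walk of `k` steps extends to a
potential for this walk followed by the covering of those vertices. -/
theorem walk_potential_step (hd : ∀ x, 0 < G.degree x) {ε e B τ : ℝ} {h : V → V → ℝ}
    (he0 : 0 ≤ e) (he1 : e ≤ 1) (hε0 : 0 ≤ ε) (hB : 0 ≤ B) (hτ : 1 ≤ τ)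
    (h0 : ∀ y x, 0 ≤ h y x) (hle : ∀ y x, h y x ≤ τ)
    (hsup : ∀ y x, x ≠ y → 1 + ∑ z, transitionMatrix G x z * h y z ≤ h y x)
    (k : ℕ) (x : V) (U : Finset V) :
    ∃ y, G.Adj x y ∧ (x ∉ U →
      1 + ((1 - ε) * ∑ z, transitionMatrix G x z *
          (k + B * ((1 - 1 / (2 * τ)) ^ k * ∑ v ∈ U, (1 + h v z / τ)) ^ e) +
        ε * (k + B * ((1 - 1 / (2 * τ)) ^ k * ∑ v ∈ U, (1 + h v y / τ)) ^ e)) ≤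
      ((k + 1 : ℕ) : ℝ) + B * ((1 - 1 / (2 * τ)) ^ (k + 1) * ∑ v ∈ U, (1 + h v x / τ)) ^ e) := by
  have hτ0 : 0 < τ := by linarith
  have hr0 : 0 ≤ 1 - 1 / (2 * τ) := by
    rw [sub_nonneg, div_le_one (by positivity)]
    linarith
  set r := 1 - 1 / (2 * τ) with hr
  let Φ : V → ℝ := fun z => r ^ k * ∑ v ∈ U, (1 + h v z / τ)
  have hΦ0 : ∀ z, 0 ≤ Φ z := fun z => mul_nonneg (pow_nonneg hr0 k)
    (Finset.sum_nonneg fun v _ => add_nonneg zero_le_one (div_nonneg (h0 v z) hτ0.le))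
  let F : V → ℝ := fun z => k + B * Φ z ^ e
  -- A controlled step to the neighbour of least potential is no worse than an uncontrolled one, so
  -- the bias does no harm in this phase.
  obtain ⟨y, hy, hmin⟩ := Finset.exists_min_image (G.neighborFinset x) F
    (by rw [← Finset.card_pos, SimpleGraph.card_neighborFinset_eq_degree]; exact hd x)
  refine ⟨y, (SimpleGraph.mem_neighborFinset _ _ _).1 hy, fun hx => ?_⟩
  change 1 + ((1 - ε) * ∑ z, transitionMatrix G x z * F z + ε * F y) ≤ _
  have h1 : F y ≤ ∑ z, transitionMatrix G x z * F z := by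
    calc F y = ∑ z, transitionMatrix G x z * F y := by
          rw [← Finset.sum_mul, sum_transitionMatrix (hd x), one_mul]
      _ ≤ _ := by
          refine Finset.sum_le_sum fun z _ => ?_
          by_cases hz : G.Adj x z
          · exact mul_le_mul_of_nonneg_left (hmin z ((SimpleGraph.mem_neighborFinset _ _ _).2 hz))
              (transitionMatrix_nonneg G x z)
          · simp [transitionMatrix, hz]
  have h2 : ∑ z, transitionMatrix G x z * F z =
      k + B * ∑ z, transitionMatrix G x z * Φ z ^ e := by
    have h3 : ∀ z, transitionMatrix G x z * F z =
        transitionMatrix G x z * k + B * (transitionMatrix G x z * Φ z ^ e) := by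
      intro z; simp only [F]; ring
    simp_rw [h3]
    rw [Finset.sum_add_distrib, ← Finset.sum_mul, ← Finset.mul_sum, sum_transitionMatrix (hd x),
      one_mul]
  have h3 : ∑ z, transitionMatrix G x z * Φ z ^ e ≤ (∑ z, transitionMatrix G x z * Φ z) ^ e := by
    have := (Real.concaveOn_rpow he0 he1).le_map_sum (t := Finset.univ)
      (w := transitionMatrix G x) (p := Φ) (fun z _ => transitionMatrix_nonneg G x z)
      (sum_transitionMatrix (hd x)) (fun z _ => hΦ0 z)
    simpa only [smul_eq_mul] using this
  have h4 : ∑ z, transitionMatrix G x z * Φ z ≤ r ^ (k + 1) * ∑ v ∈ U, (1 + h v x / τ) := by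
    have h5 : ∑ z, transitionMatrix G x z * Φ z =
        r ^ k * ∑ v ∈ U, (1 + (∑ z, transitionMatrix G x z * h v z) / τ) := by
      have h6 : ∀ z, transitionMatrix G x z * Φ z =
          ∑ v ∈ U, r ^ k * (transitionMatrix G x z + transitionMatrix G x z * h v z / τ) := by
        intro z
        simp only [Φ]
        rw [Finset.mul_sum, Finset.mul_sum]
        exact Finset.sum_congr rfl fun v _ => by ring
      simp_rw [h6]
      rw [Finset.sum_comm, Finset.mul_sum]
      refine Finset.sum_congr rfl fun v _ => ?_
      rw [← Finset.mul_sum, Finset.sum_add_distrib, sum_transitionMatrix (hd x), Finset.sum_div]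
    rw [h5, pow_succ, mul_assoc]
    refine mul_le_mul_of_nonneg_left ?_ (pow_nonneg hr0 k)
    rw [Finset.mul_sum]
    refine Finset.sum_le_sum fun v hv => ?_
    have h7 := hsup v x fun hxv => hx (hxv ▸ hv)
    have h8 : (∑ z, transitionMatrix G x z * h v z) / τ ≤ (h v x - 1) / τ :=
      div_le_div_of_nonneg_right (by linarith) hτ0.le
    refine (add_le_add_right h8 1).trans ?_
    -- A step lowers 1 + h/τ by at least 1/τ, and 1 + h/τ ≤ 2 turns this into the factor r.
    have h9 : r * (1 + h v x / τ) - (1 + (h v x - 1) / τ) = (τ - h v x) / (2 * τ ^ 2) := by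
      rw [hr]
      field_simp
      ring
    have h10 : 0 ≤ (τ - h v x) / (2 * τ ^ 2) :=
      div_nonneg (sub_nonneg.2 (hle v x)) (by positivity)
    linarith
  have h5 : (∑ z, transitionMatrix G x z * Φ z) ^ e ≤
      (r ^ (k + 1) * ∑ v ∈ U, (1 + h v x / τ)) ^ e :=
    Real.rpow_le_rpow (Finset.sum_nonneg fun z _ =>
      mul_nonneg (transitionMatrix_nonneg G x z) (hΦ0 z)) h4 he0
  have h6 := mul_le_mul_of_nonneg_left (h3.trans h5) hB
  have h7 := mul_le_mul_of_nonneg_left h1 hε0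
  push_cast
  linarith

theorem minDegree_pos [Nonempty V] (hd : ∀ x, 0 < G.degree x) : (0 : ℝ) < G.minDegree := by
  obtain ⟨v, hv⟩ := G.exists_minimal_degree_vertex
  rw [hv]; exact_mod_cast hd v

theorem minDegree_le_avgDegree [Nonempty V] : (G.minDegree : ℝ) ≤ avgDegree G := by
  have hn : (0 : ℝ) < Fintype.card V := by exact_mod_cast Fintype.card_pos
  rw [avgDegree, le_div_iff₀ hn, mul_comm, ← nsmul_eq_mul, ← Finset.card_univ]
  exact Finset.card_nsmul_le_sum _ _ _ fun v _ => by exact_mod_cast G.minDegree_le_degree v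

variable [DecidableEq V]

theorem one_le_relaxationTime (hd : ∀ x, 0 < G.degree x) : 1 ≤ relaxationTime G :=
  (one_le_inv₀ (sub_pos.2 (lazyLambda₂_lt_one hd))).2 (by linarith [lazyLambda₂_nonneg hd])

/-- From λ₂ ≤ exp(-(1 - λ₂)) one gets λ₂^k ≤ n^(-4), so the product is at most 2/n. -/
theorem lazyLambda₂_pow_mul_le_one (hd : ∀ x, 0 < G.degree x) (hn : 3 ≤ Fintype.card V) {k : ℕ}
    (hk : 4 * (relaxationTime G * Real.log (Fintype.card V)) ≤ k) :
    lazyLambda₂ G ^ k * (2 * (Fintype.card V : ℝ) ^ 3) ≤ 1 := by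
  have hn' : (3 : ℝ) ≤ Fintype.card V := by exact_mod_cast hn
  set n : ℝ := (Fintype.card V : ℝ)
  have hn0 : 0 < n := by linarith
  have hlt := lazyLambda₂_lt_one hd
  have h1 : lazyLambda₂ G ≤ Real.exp (-(1 - lazyLambda₂ G)) := by
    have := Real.add_one_le_exp (-(1 - lazyLambda₂ G))
    linarith
  have h2 : lazyLambda₂ G ^ k ≤ Real.exp (-(4 * Real.log n)) := by
    refine (pow_le_pow_left₀ (lazyLambda₂_nonneg hd) h1 k).trans ?_
    rw [← Real.exp_nat_mul]
    refine Real.exp_le_exp.2 ?_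
    have h3 : 4 * Real.log n ≤ k * (1 - lazyLambda₂ G) := by
      have h4 := mul_le_mul_of_nonneg_right hk (sub_pos.2 hlt).le
      have h5 : relaxationTime G * (1 - lazyLambda₂ G) = 1 :=
        inv_mul_cancel₀ (sub_pos.2 hlt).ne'
      calc 4 * Real.log n
          = 4 * (relaxationTime G * Real.log n) * (1 - lazyLambda₂ G) := by
            linear_combination (-4 * Real.log n) * h5
        _ ≤ _ := h4
    linarith
  have h3 : Real.exp (-(4 * Real.log n)) = (n ^ 4)⁻¹ := by
    rw [Real.exp_neg, mul_comm, Real.exp_mul, Real.exp_log hn0]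
    norm_cast
  rw [h3] at h2
  calc lazyLambda₂ G ^ k * (2 * n ^ 3) ≤ (n ^ 4)⁻¹ * (2 * n ^ 3) := by gcongr
    _ = 2 / n := by field_simp
    _ ≤ 1 := (div_le_one hn0).2 (by linarith)

variable [MeasurableSpace V] [DiscreteMeasurableSpace V]

theorem tCov_le_of_potential (hd : ∀ x, 0 < G.degree x) (ε : unitInterval) {e B τ : ℝ}
    {h : V → V → ℝ} (he0 : 0 ≤ e) (he1 : e ≤ 1) (hB : 0 ≤ B) (hτ : 1 ≤ τ)
    (h0 : ∀ y x, 0 ≤ h y x) (hle : ∀ y x, h y x ≤ τ)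
    (hsup : ∀ y x, x ≠ y → 1 + ∑ z, transitionMatrix G x z * h y z ≤ h y x)
    {W : V → Finset V → ℝ} (hW0 : ∀ x, W x ∅ = 0) (hWnn : ∀ x U, 0 ≤ W x U)
    (hWB : ∀ x U, W x U ≤ B * (U.card : ℝ) ^ e)
    (hstep : ∀ x U, ∃ y, G.Adj x y ∧ (x ∉ U → U.Nonempty →
        1 + ((1 - ε) * ∑ z, transitionMatrix G x z * W z (U.erase z) + ε * W y (U.erase y)) ≤
          W x U)) (T : ℕ) :
    tCov G ε ≤ ENNReal.ofReal
      (T + B * ((1 - 1 / (2 * τ)) ^ T * (2 * Fintype.card V)) ^ e) := by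
  have hτ0 : 0 < τ := by linarith
  have hr0 : 0 ≤ 1 - 1 / (2 * τ) := by
    rw [sub_nonneg, div_le_one (by positivity)]
    linarith
  have hε1 : (0 : ℝ) ≤ 1 - ε := sub_nonneg.2 ε.2.2
  have hε0 : (0 : ℝ) ≤ ε := ε.2.1
  let F : ℕ → V → Finset V → ℝ := fun k z U =>
    k + B * ((1 - 1 / (2 * τ)) ^ k * ∑ v ∈ U, (1 + h v z / τ)) ^ e
  have hsum0 : ∀ z (U : Finset V), 0 ≤ ∑ v ∈ U, (1 + h v z / τ) := fun z U =>
    Finset.sum_nonneg fun v _ => add_nonneg zero_le_one (div_nonneg (h0 v z) hτ0.le)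
  have hF0 : ∀ k z U, 0 ≤ F k z U := fun k z U => add_nonneg (Nat.cast_nonneg k)
    (mul_nonneg hB (Real.rpow_nonneg (mul_nonneg (pow_nonneg hr0 k) (hsum0 z U)) e))
  have hFmono : ∀ k z (U U' : Finset V), U ⊆ U' → F k z U ≤ F k z U' := by
    intro k z U U' hUU
    refine add_le_add le_rfl (mul_le_mul_of_nonneg_left (Real.rpow_le_rpow
      (mul_nonneg (pow_nonneg hr0 k) (hsum0 z U)) (mul_le_mul_of_nonneg_left ?_
      (pow_nonneg hr0 k)) he0) hB)
    exact Finset.sum_le_sum_of_subset_of_nonneg hUU fun v _ _ =>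
      add_nonneg zero_le_one (div_nonneg (h0 v z) hτ0.le)
  -- k counts the steps left in phase one. Truncated subtraction keeps `T - t` at 0 from time T on,
  -- so phase two then runs with the stationary potential W.
  let Y : ℕ → V → Finset V → ℝ := fun k z U =>
    if k = 0 then W z U else if U = ∅ then 0 else F k z U
  have hYF : ∀ k z U, Y k z U ≤ F k z U := by
    intro k z U
    simp only [Y]
    split_ifs with hk hU
    · subst hk
      refine (hWB z U).trans ?_
      simp only [F, Nat.cast_zero, zero_add, pow_zero, one_mul]
      refine mul_le_mul_of_nonneg_left (Real.rpow_le_rpow (Nat.cast_nonneg _) ?_ he0) hB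
      rw [Finset.sum_add_distrib, Finset.sum_const, nsmul_eq_mul, mul_one]
      exact le_add_of_nonneg_right
        (Finset.sum_nonneg fun v _ => div_nonneg (h0 v z) hτ0.le)
    · exact hF0 k z U
    · exact le_rfl
  refine iSup_le fun u => ?_
  refine (iInf_lintegral_coverTime_le hd ε (fun t => Y (T - t)) (fun t x U => ?_)
    (fun t x => ?_) (fun t x U => ?_) u).trans (ENNReal.ofReal_le_ofReal ?_)
  · simp only [Y]
    split_ifs
    · exact hWnn x U
    · exact le_rfl
    · exact hF0 _ x U
  · simp [Y, hW0]
  · rcases Nat.eq_zero_or_pos (T - t) with hk | hk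
    · have hk' : T - (t + 1) = 0 := by omega
      simp only [hk, hk', Y, if_true]
      exact hstep x U
    · obtain ⟨k, hk1⟩ : ∃ k, T - t = k + 1 := ⟨T - t - 1, by omega⟩
      have hk2 : T - (t + 1) = k := by omega
      obtain ⟨y, hy, hxy⟩ := walk_potential_step hd he0 he1 hε0 hB hτ h0 hle hsup k x U
      refine ⟨y, hy, fun hx hU => ?_⟩
      have hYU : Y (T - t) x U = F (k + 1) x U := by
        simp only [Y, hk1, if_neg (Nat.succ_ne_zero k), if_neg hU.ne_empty]
      rw [hYU, hk2]
      refine le_trans ?_ (hxy hx)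
      have hz : ∀ z, Y k z (U.erase z) ≤ F k z U := fun z =>
        (hYF k z _).trans (hFmono k z _ _ (Finset.erase_subset z U))
      refine add_le_add le_rfl (add_le_add (mul_le_mul_of_nonneg_left (Finset.sum_le_sum fun z _ =>
        mul_le_mul_of_nonneg_left (hz z) (transitionMatrix_nonneg G x z)) hε1)
        (mul_le_mul_of_nonneg_left (hz y) hε0))
  · rw [Nat.sub_zero]
    refine (hYF T u _).trans (add_le_add le_rfl (mul_le_mul_of_nonneg_left (Real.rpow_le_rpow
      (mul_nonneg (pow_nonneg hr0 T) (hsum0 u _)) (mul_le_mul_of_nonneg_left ?_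
      (pow_nonneg hr0 T)) he0) hB))
    have h1 : ∀ v ∈ Finset.univ.erase u, 1 + h v u / τ ≤ (2 : ℝ) := by
      intro v _
      have := (div_le_one hτ0).2 (hle v u)
      linarith
    refine (Finset.sum_le_card_nsmul _ _ _ h1).trans ?_
    rw [nsmul_eq_mul, mul_comm]
    refine mul_le_mul_of_nonneg_left ?_ (by norm_num)
    exact_mod_cast Finset.card_le_univ _

/-- The bound on the cover time in terms of a real hitting time bound. -/
theorem tCov_le_of_supersolution (hG : G.Connected) (hn : 3 ≤ Fintype.card V)
    (hd : ∀ x, 0 < G.degree x) {ε : unitInterval} (hε : 0 < ε) {τ K : ℝ} {h : V → V → ℝ}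
    (h0 : ∀ y x, 0 ≤ h y x) (hle : ∀ y x, h y x ≤ τ)
    (hsup : ∀ y x, x ≠ y → 1 + ∑ z, transitionMatrix G x z * h y z ≤ h y x)
    (hK : K = avgDegree G * relaxationTime G * Real.log (Fintype.card V) / G.minDegree)
    (hK1 : 1 < K) :
    tCov G ε ≤ ENNReal.ofReal (τ * (4 * Real.log K + 2162) / ε) := by
  have := hG.nonempty
  have hn' : (3 : ℝ) ≤ Fintype.card V := by exact_mod_cast hn
  have hτn := card_le_one_add_of_supersolution hd h0 hle hsup
  have hε' : (0 : ℝ) < ε := hε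
  have htrel := one_le_relaxationTime hd
  set n : ℝ := (Fintype.card V : ℝ) with hndef
  have hlog : 1 ≤ Real.log n := by
    rw [Real.le_log_iff_exp_le (by linarith)]
    linarith [Real.exp_one_lt_d9]
  have hmin := minDegree_pos hd
  have hD : avgDegree G * n = ∑ v, (G.degree v : ℝ) := by
    rw [avgDegree, div_mul_cancel₀ _ (by linarith)]
  have hdavg := minDegree_le_avgDegree (G := G)
  -- The cap at 1/2 covers large ε and costs only a factor 2, as ε ≤ 2e.
  set e : ℝ := min ε (1 / 2) with he
  have he0 : 0 < e := lt_min hε' (by norm_num)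
  have he2 : e ≤ 1 / 2 := min_le_right _ _
  have heε : e ≤ ε := min_le_left _ _
  have hεe : (ε : ℝ) ≤ 2 * e := by
    have := ε.2.2
    rcases le_total (ε : ℝ) (1 / 2) with h | h
    · rw [he, min_eq_left h]; linarith
    · rw [he, min_eq_right h]; linarith
  set s := relaxationTime G * Real.log n with hs
  have hs1 : 1 ≤ s := by nlinarith
  set T := ⌈4 * s⌉₊ with hT
  have hT1 : 4 * s ≤ T := Nat.le_ceil _
  have hT2 : (T : ℝ) ≤ 5 * s := by
    have := Nat.ceil_lt_add_one (show 0 ≤ 4 * s by linarith)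
    linarith
  have hT0 : 0 < T := Nat.ceil_pos.2 (by linarith)
  set Q := 18 * (n * avgDegree G / G.minDegree) with hQ
  have hQn : 18 * n ≤ Q := by
    rw [hQ, mul_div_assoc]
    have : 1 ≤ avgDegree G / G.minDegree := (one_le_div hmin).2 hdavg
    nlinarith
  have hQ0 : 0 < Q := by linarith
  set B := 6 * T * Q ^ (1 - e) / e with hB
  have hB0 : 0 ≤ B := by positivity
  obtain ⟨W, hW1, hW2, hW3, hW4⟩ := exists_cover_potential hG hd hT0
    (fun k hk => lazyLambda₂_pow_mul_le_one hd hn (hT1.trans (by exact_mod_cast hk)))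
    he0 he2 heε ε.2.2 hQ0 (by rw [← hD, hQ]; field_simp; exact le_rfl) hB
  -- Just long enough for (1 - 1/(2τ))^(Ne) ≤ 1/K.
  set N := ⌈2 * τ * Real.log K / e⌉₊ with hN
  have hlogK : 0 < Real.log K := Real.log_pos hK1
  have hN1 : 2 * τ * Real.log K / e ≤ N := Nat.le_ceil _
  have hN2 : (N : ℝ) ≤ 2 * τ * Real.log K / e + 1 :=
    (Nat.ceil_lt_add_one (div_nonneg (mul_nonneg (by linarith) hlogK.le) he0.le)).le
  refine (tCov_le_of_potential hd ε he0.le (by linarith) hB0 (by linarith) h0 hle hsup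
    hW1 hW2 hW3 hW4 N).trans (ENNReal.ofReal_le_ofReal ?_)
  have hτ0 : 0 < τ := by linarith
  have hr0 : 0 ≤ 1 - 1 / (2 * τ) := by
    rw [sub_nonneg, div_le_one (by positivity)]
    linarith
  have hpow : ((1 - 1 / (2 * τ)) ^ N) ^ e ≤ K⁻¹ := by
    have h1 : 1 - 1 / (2 * τ) ≤ Real.exp (-(1 / (2 * τ))) := by
      have := Real.add_one_le_exp (-(1 / (2 * τ)))
      linarith
    calc ((1 - 1 / (2 * τ)) ^ N) ^ e ≤ (Real.exp (-(1 / (2 * τ))) ^ N) ^ e :=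
          Real.rpow_le_rpow (pow_nonneg hr0 N) (pow_le_pow_left₀ hr0 h1 N) he0.le
      _ = Real.exp (-(N / (2 * τ) * e)) := by
          rw [← Real.exp_nat_mul, ← Real.exp_mul]
          congr 1
          ring
      _ ≤ Real.exp (-Real.log K) := by
          refine Real.exp_le_exp.2 (neg_le_neg ?_)
          rw [div_le_iff₀ he0] at hN1
          rw [div_mul_eq_mul_div, le_div_iff₀ (by positivity)]
          linarith
      _ = K⁻¹ := by rw [Real.exp_neg, Real.exp_log (by linarith)]
  -- As 2n ≤ Q, the powers of Q and 2n combine to at most Q, and the 1/K cancels t_rel log n ·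
  -- d_avg/d_min. The constant is 540 = 6 · 5 · 18.
  have hmain : B * ((1 - 1 / (2 * τ)) ^ N * (2 * n)) ^ e ≤ 540 * n / e := by
    rw [Real.mul_rpow (pow_nonneg hr0 N) (by linarith)]
    have h1 : Q ^ (1 - e) * (2 * n) ^ e ≤ Q := by
      calc Q ^ (1 - e) * (2 * n) ^ e ≤ Q ^ (1 - e) * Q ^ e := by
            gcongr
            linarith
        _ = Q := by rw [← Real.rpow_add hQ0, sub_add_cancel, Real.rpow_one]
    have hK' : K = s * (avgDegree G / G.minDegree) := by rw [hK, hs]; ring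
    calc B * (((1 - 1 / (2 * τ)) ^ N) ^ e * (2 * n) ^ e)
        ≤ B * (K⁻¹ * (2 * n) ^ e) := by gcongr
      _ = 6 * T / e * K⁻¹ * (Q ^ (1 - e) * (2 * n) ^ e) := by rw [hB]; ring
      _ ≤ 6 * (5 * s) / e * K⁻¹ * Q := by
          have : 0 ≤ K⁻¹ := inv_nonneg.2 (by linarith)
          gcongr
      _ = 540 * n / e := by
          rw [hK', hQ]
          have hav : avgDegree G ≠ 0 := by linarith
          field_simp
          ring
  -- Since τ ≥ n - 1 ≥ 2, one has n ≤ 2τ, giving 1080; the rounding of N adds 1.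
  have hfin : (N : ℝ) + B * ((1 - 1 / (2 * τ)) ^ N * (2 * n)) ^ e ≤
      τ * (2 * Real.log K + 1081) / e := by
    have h1 : 1 ≤ τ / e := (one_le_div he0).2 (by linarith)
    have h2 : 540 * n / e ≤ 1080 * (τ / e) := by
      rw [mul_div_assoc', div_le_div_iff_of_pos_right he0]
      linarith
    have h3 : τ * (2 * Real.log K + 1081) / e = 2 * τ * Real.log K / e + 1081 * (τ / e) := by ring
    linarith
  refine hfin.trans ?_
  rw [div_le_div_iff₀ he0 hε']
  have h4 : 0 ≤ τ * (2 * Real.log K + 1081) := by positivity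
  calc τ * (2 * Real.log K + 1081) * ε ≤ τ * (2 * Real.log K + 1081) * (2 * e) := by gcongr
    _ = _ := by ring

end Main

end BiasedWalk

end

theorem theorem3p2 :
    ∃ C : ℝ, 0 < C ∧
      ∀ (V : Type*) [Fintype V] [DecidableEq V] [MeasurableSpace V] [DiscreteMeasurableSpace V]
        (G : SimpleGraph V) [DecidableRel G.Adj],
        G.Connected → 3 ≤ Fintype.card V →
          ∀ ε : unitInterval, 0 < ε → ε < 1 →
            BiasedWalk.tCov G ε ≤
              ENNReal.ofReal
                (C / (ε : ℝ) *
                  Real.log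
                    (BiasedWalk.avgDegree G * BiasedWalk.relaxationTime G *
                      Real.log (Fintype.card V : ℝ) / (G.minDegree : ℝ))) *
                BiasedWalk.tHit G := by
  have hlog3 : 1 < Real.log 3 := by
    rw [Real.lt_log_iff_exp_lt (by norm_num)]
    linarith [Real.exp_one_lt_d9]
  have hc : 0 < Real.log (Real.log 3) := Real.log_pos hlog3
  -- The additive 2162 is absorbed because K ≥ log 3 > 1 keeps log K above a positive constant.
  refine ⟨4 + 2162 / Real.log (Real.log 3), by positivity, ?_⟩
  intro V _ _ _ _ G _ hG hn ε hε _
  have hn' : (3 : ℝ) ≤ Fintype.card V := by exact_mod_cast hn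
  have : Nontrivial V := Fintype.one_lt_card_iff_nontrivial.1 (by omega)
  have hd : ∀ x, 0 < G.degree x := fun x => hG.preconnected.degree_pos_of_nontrivial x
  have hε' : (0 : ℝ) < ε := hε
  set K := BiasedWalk.avgDegree G * BiasedWalk.relaxationTime G *
    Real.log (Fintype.card V : ℝ) / (G.minDegree : ℝ) with hK
  have hmin := BiasedWalk.minDegree_pos hd
  have hdavg := BiasedWalk.minDegree_le_avgDegree (G := G)
  have hdavg0 := hmin.le.trans hdavg
  have hK3 : Real.log 3 ≤ K := by
    rw [hK, le_div_iff₀ hmin]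
    have h1 : Real.log 3 ≤ Real.log (Fintype.card V : ℝ) := Real.log_le_log (by norm_num) hn'
    have h2 := BiasedWalk.one_le_relaxationTime hd
    calc Real.log 3 * G.minDegree = G.minDegree * 1 * Real.log 3 := by ring
      _ ≤ _ := by gcongr
  have hL : Real.log (Real.log 3) ≤ Real.log K := Real.log_le_log (by linarith) hK3
  have hL0 : 0 < Real.log K := hc.trans_le hL
  -- An infinite hitting time makes the right side infinite, as its other factor is positive;
  -- finiteness need not be proved.
  by_cases hτ : BiasedWalk.tHit G = ⊤
  · rw [hτ, ENNReal.mul_top]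
    · exact le_top
    · rw [ENNReal.ofReal_ne_zero_iff]
      positivity
  · obtain ⟨h, h0, hle, hsup⟩ := BiasedWalk.exists_hitting_supersolution hd hτ
    refine (BiasedWalk.tCov_le_of_supersolution hG hn hd hε h0 hle hsup hK
      (hlog3.trans_le hK3)).trans ?_
    rw [← ENNReal.ofReal_toReal hτ, ENNReal.toReal_ofReal ENNReal.toReal_nonneg,
      ← ENNReal.ofReal_mul (by positivity)]
    refine ENNReal.ofReal_le_ofReal ?_
    have h1 : (2162 : ℝ) ≤ 2162 / Real.log (Real.log 3) * Real.log K := by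
      rw [div_mul_eq_mul_div, le_div_iff₀ hc]
      linarith
    calc (BiasedWalk.tHit G).toReal * (4 * Real.log K + 2162) / ε
        ≤ (BiasedWalk.tHit G).toReal *
          (4 * Real.log K + 2162 / Real.log (Real.log 3) * Real.log K) / ε := by gcongr
      _ = _ := by ring
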